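/- Let $(\mathbb{X},d)$ be a complete and separable metric space, let $\nu$ be a nonnegative Borel measure on $\mathbb{X}$ which is finite on bounded sets, and let $1<p<\infty$, $\frac1p+\frac1{p'}=1$. Notation. Let $D^{1,p}(\mathbb{X})$ be the class of Borel functions $u:\mathbb{X}\to\mathbb{R}$ which have an upper gradient in $L^p(\mathbb{X},\nu)$, let $|Du|$ be the minimal $p$-weak upper gradient of $u$, and let $W^{1,p}(\mathbb{X},d,\nu)=D^{1,p}(\mathbb{X})\cap L^p(\mathbb{X},\nu)$ (an element of $L^2(\mathbb{X},\nu)$ belongs to $W^{1,p}$ if it has a representative in $D^{1,p}(\mathbb{X})$ and lies in $L^p$). Let $L^p(T^*\mathbb{X})$ be Gigli's cotangent module, i.e. the completion of the space of families $\{(f_i,A_i)\}_{i\in\mathbb{N}}$, where $(A_i)$ is a Borel partition of $\mathbb{X}$, $f_i\in D^{1,p}(\mathbb{X})$ and $\sum_i\int_{A_i}|Df_i|^p\,d\nu<\infty$, with respect to the norm $\left(\sum_i\int_{A_i}|Df_i|^p\,d\nu\right)^{1/p}$, where $\{(f_i,A_i)\}$ and $\{(g_j,B_j)\}$ are identified if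 $|D(f_i-g_j)|=0$ $\nu$-a.e. on $A_i\cap B_j$ for all $i,j$; it is an $L^\infty(\mathbb{X},\nu)$-module with pointwise norm $|\cdot|_*$, the continuous extension of $|\{(f_i,A_i)\}|_*=|Df_i|$ on $A_i$. For $f\in D^{1,p}(\mathbb{X})$ its differential is $df=(f,\mathbb{X})$. Let $L^{p'}(T\mathbb{X})$ be the dual module, i.e. the space of bounded linear maps $X:L^p(T^*\mathbb{X})\to L^1(\mathbb{X},\nu)$, $v\mapsto v(X)$, which commute with multiplication by functions in $L^\infty(\mathbb{X},\nu)$. Let $\mathcal{D}^{p',2}(\mathbb{X})$ be the set of those $X\in L^{p'}(T\mathbb{X})$ for which there is $f\in L^2(\mathbb{X},\nu)$ with $$\int_{\mathbb{X}} fg\,d\nu=-\int_{\mathbb{X}} dg(X)\,d\nu\qquad\text{for all } g\in W^{1,p}(\mathbb{X},d,\nu)\cap L^2(\mathbb{X},\nu);$$ we then write $\mathrm{div}(X)=f$. Theorem. Let $E:L^p(T^*\mathbb{X})\to\mathbb{R}$ be convex and continuous, and suppose that there is $C>0$ such that $E(v)\ge C\int_{\mathbb{X}}|v|_*^p\,d\nu$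 for all $v\in L^p(T^*\mathbb{X})$. Define $\mathcal{F}:L^2(\mathbb{X},\nu)\to[0,+\infty]$ by $\mathcal{F}(u)=E(du)$ if $u\in W^{1,p}(\mathbb{X},d,\nu)$ and $\mathcal{F}(u)=+\infty$ otherwise, and suppose that $\mathcal{F}$ (which is convex since $E$ is) is lower semicontinuous on $L^2(\mathbb{X},\nu)$. Then, for all $u,v\in L^2(\mathbb{X},\nu)$, we have $v\in\partial\mathcal{F}(u)$ if and only if $u\in W^{1,p}(\mathbb{X},d,\nu)$ and there exists $X\in\mathcal{D}^{p',2}(\mathbb{X})$ such that $$-\mathrm{div}(X)=v\qquad\text{and}\qquad X\in\partial E(du),$$ where $X\in\partial E(\omega)$ means that $E(\omega+w)-E(\omega)\ge\int_{\mathbb{X}}w(X)\,d\nu$ for all $w\in L^p(T^*\mathbb{X})$. Moreover, the domain $\{u\in L^2(\mathbb{X},\nu):\partial\mathcal{F}(u)\neq\emptyset\}$ is dense in $L^2(\mathbb{X},\nu)$. -/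

import Mathlib

open MeasureTheory Set Filter Topology
open scoped ENNReal NNReal

noncomputable section

set_option linter.unusedSectionVars false

namespace MetricSobolev

section Curves

/-- A rectifiable curve in `X`, parametrised by arc length on a compact interval `[a, b]`
(so its metric speed is `1` almost everywhere). Values of `toFun` outside `[a, b]` are irrelevant. -/
structure Curve (X : Type*) [MetricSpace X] where
  toFun : ℝ → X
  a : ℝ
  b : ℝ
  le : a ≤ b
  unitSpeed : HasUnitSpeedOn toFun (Icc a b)

variable {X : Type*} [MetricSpace X]

/-- The line integral `∫_γ g ds`. -/
def lineIntegral (g : X → ℝ≥0∞) (γ : Curve X) : ℝ≥0∞ :=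
  ∫⁻ t in Icc γ.a γ.b, g (γ.toFun t)

variable [MeasurableSpace X]

/-- The `p`-modulus of a family of curves. -/
def modulus (ν : Measure X) (p : ℝ) (Γ : Set (Curve X)) : ℝ≥0∞ :=
  ⨅ (ρ : X → ℝ≥0∞) (_ : Measurable ρ) (_ : ∀ γ ∈ Γ, 1 ≤ lineIntegral ρ γ), ∫⁻ x, ρ x ^ p ∂ν

/-- The upper gradient inequality `|u(γ(b)) - u(γ(a))| ≤ ∫_γ g ds` along the curve `γ`. -/
def UpperGradientIneq (u : X → ℝ) (g : X → ℝ≥0∞) (γ : Curve X) : Prop :=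
  ENNReal.ofReal |u (γ.toFun γ.b) - u (γ.toFun γ.a)| ≤ lineIntegral g γ

/-- `g` is an upper gradient of `u`. -/
def IsUpperGradient (u : X → ℝ) (g : X → ℝ≥0∞) : Prop :=
  Measurable g ∧ ∀ γ : Curve X, UpperGradientIneq u g γ

/-- `g` is a `p`-weak upper gradient of `u`. -/
def IsWeakUpperGradient (ν : Measure X) (p : ℝ) (u : X → ℝ) (g : X → ℝ≥0∞) : Prop :=
  Measurable g ∧ modulus ν p {γ | ¬ UpperGradientIneq u g γ} = 0

/-- `g` is a minimal `p`-weak upper gradient of `u`: a `p`-weak upper gradient in `L^p` which is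
`ν`-a.e. below every other `p`-weak upper gradient in `L^p`. -/
def IsMinimalWeakUpperGradient (ν : Measure X) (p : ℝ) (u : X → ℝ) (g : X → ℝ≥0∞) : Prop :=
  IsWeakUpperGradient ν p u g ∧ ∫⁻ x, g x ^ p ∂ν < ∞ ∧
    ∀ g' : X → ℝ≥0∞, IsWeakUpperGradient ν p u g' → ∫⁻ x, g' x ^ p ∂ν < ∞ → g ≤ᵐ[ν] g'

/-! ### Existence of the minimal weak upper gradient -/

/-- The restriction of a curve to a subinterval. -/
def Curve.sub (γ : Curve X) (s t : ℝ) (hs : γ.a ≤ s) (hst : s ≤ t) (ht : t ≤ γ.b) : Curve X where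
  toFun := γ.toFun
  a := s
  b := t
  le := hst
  unitSpeed := by
    intro x hx y hy
    have h := γ.unitSpeed (x := x) ⟨hs.trans hx.1, hx.2.trans ht⟩ (y := y)
      ⟨hs.trans hy.1, hy.2.trans ht⟩
    rw [← h]
    congr 1
    ext z
    simp only [mem_inter_iff, mem_Icc] at *
    constructor
    · rintro ⟨h1, h2⟩; exact ⟨⟨by linarith, by linarith⟩, h2⟩
    · rintro ⟨h1, h2⟩; exact ⟨⟨by linarith, by linarith⟩, h2⟩

lemma Curve.continuousOn (γ : Curve X) : ContinuousOn γ.toFun (Icc γ.a γ.b) := by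
  have : LipschitzOnWith 1 γ.toFun (Icc γ.a γ.b) := by
    have key : ∀ x ∈ Icc γ.a γ.b, ∀ y ∈ Icc γ.a γ.b, x ≤ y →
        edist (γ.toFun x) (γ.toFun y) ≤ edist x y := by
      intro x hx y hy hxy
      have h := γ.unitSpeed hx hy
      have h2 := eVariationOn.edist_le γ.toFun (s := Icc γ.a γ.b ∩ Icc x y)
        ⟨hx, left_mem_Icc.2 hxy⟩ ⟨hy, right_mem_Icc.2 hxy⟩
      rw [h] at h2
      refine h2.trans ?_
      rw [edist_comm, edist_dist, Real.dist_eq, abs_of_nonneg (by linarith)]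
      simp
    intro x hx y hy
    rw [ENNReal.coe_one, one_mul]
    rcases le_total x y with h | h
    · exact key x hx y hy h
    · rw [edist_comm, edist_comm x]; exact key y hy x hx h
  exact this.continuousOn

variable [BorelSpace X] {ν : Measure X} {p : ℝ}

lemma Curve.aemeasurable_comp (γ : Curve X) {g : X → ℝ≥0∞} (hg : Measurable g) :
    AEMeasurable (fun t => g (γ.toFun t)) (volume.restrict (Icc γ.a γ.b)) :=
  hg.comp_aemeasurable (γ.continuousOn.aemeasurable measurableSet_Icc)

lemma lineIntegral_mono {g h : X → ℝ≥0∞} (hgh : ∀ x, g x ≤ h x) (γ : Curve X) :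
    lineIntegral g γ ≤ lineIntegral h γ :=
  lintegral_mono fun _ => hgh _

lemma modulus_mono {Γ Γ' : Set (Curve X)} (h : Γ ⊆ Γ') : modulus ν p Γ ≤ modulus ν p Γ' :=
  le_iInf fun ρ => le_iInf fun hρ => le_iInf fun hΓ =>
    iInf_le_of_le ρ (iInf_le_of_le hρ (iInf_le_of_le (fun γ hγ => hΓ γ (h hγ)) le_rfl))

/-- A family on which a single `L^p` function has infinite line integrals is negligible. -/
lemma modulus_eq_zero_of (hp : 0 < p) {Γ : Set (Curve X)} {ρ : X → ℝ≥0∞} (hρ : Measurable ρ)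
    (hfin : ∫⁻ x, ρ x ^ p ∂ν < ∞) (h : ∀ γ ∈ Γ, lineIntegral ρ γ = ∞) : modulus ν p Γ = 0 := by
  have key : ∀ n : ℕ, modulus ν p Γ ≤ (((n : ℝ≥0∞) + 1)⁻¹) ^ p * ∫⁻ x, ρ x ^ p ∂ν := by
    intro n
    have hc : ((n : ℝ≥0∞) + 1)⁻¹ ≠ 0 := ENNReal.inv_ne_zero.2 (by simp)
    refine iInf_le_of_le (fun x => ((n : ℝ≥0∞) + 1)⁻¹ * ρ x) (iInf_le_of_le (hρ.const_mul _)
      (iInf_le_of_le ?_ ?_))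
    · intro γ hγ
      rw [lineIntegral, lintegral_const_mul'' _ (γ.aemeasurable_comp hρ)]
      rw [show ∫⁻ t in Icc γ.a γ.b, ρ (γ.toFun t) = ∞ from h γ hγ, ENNReal.mul_top hc]
      exact le_top
    · simp_rw [ENNReal.mul_rpow_of_nonneg _ _ hp.le]
      rw [lintegral_const_mul _ (hρ.pow_const p)]
  have hlim : Tendsto (fun n : ℕ => (((n : ℝ≥0∞) + 1)⁻¹) ^ p * ∫⁻ x, ρ x ^ p ∂ν) atTop (𝓝 0) := by
    have h1 : Tendsto (fun n : ℕ => ((n : ℝ≥0∞) + 1)⁻¹) atTop (𝓝 0) := by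
      have := (tendsto_add_atTop_iff_nat 1).2 ENNReal.tendsto_inv_nat_nhds_zero
      simpa using this
    have h2 := (ENNReal.continuous_rpow_const (y := p)).tendsto 0 |>.comp h1
    rw [ENNReal.zero_rpow_of_pos hp] at h2
    have h3 := ENNReal.Tendsto.mul_const h2 (Or.inr hfin.ne) 
    simpa using h3
  exact le_antisymm (ge_of_tendsto' hlim key) bot_le


/-- Countably many negligible families admit a single `L^p` function with infinite line integrals
on all of them. -/
lemma exists_of_modulus_eq_zero (hp : 0 < p) {Γ : ℕ → Set (Curve X)}
    (h : ∀ k, modulus ν p (Γ k) = 0) :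
    ∃ ρ : X → ℝ≥0∞, Measurable ρ ∧ ∫⁻ x, ρ x ^ p ∂ν < ∞ ∧
      ∀ k, ∀ γ ∈ Γ k, lineIntegral ρ γ = ∞ := by
  obtain ⟨ε, hε, hsum⟩ := ENNReal.exists_pos_sum_of_countable' one_ne_zero (ℕ × ℕ)
  have hex : ∀ i : ℕ × ℕ, ∃ ρ : X → ℝ≥0∞, Measurable ρ ∧ (∀ γ ∈ Γ i.2, 1 ≤ lineIntegral ρ γ) ∧
      ∫⁻ x, ((i.1 : ℝ≥0∞) * ρ x) ^ p ∂ν ≤ ε i := by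
    intro i
    have hc : (i.1 : ℝ≥0∞) ^ p ≠ ∞ := ENNReal.rpow_ne_top_of_nonneg hp.le (by simp)
    have hlt : modulus ν p (Γ i.2) < ε i / (i.1 : ℝ≥0∞) ^ p := by
      rw [h]; exact ENNReal.div_pos (hε i).ne' hc
    simp only [modulus, iInf_lt_iff] at hlt
    obtain ⟨ρ, hρ, hadm, hlt⟩ := hlt
    refine ⟨ρ, hρ, hadm, ?_⟩
    simp_rw [ENNReal.mul_rpow_of_nonneg _ _ hp.le]
    rw [lintegral_const_mul _ (hρ.pow_const p), mul_comm]
    by_cases hi : (i.1 : ℝ≥0∞) ^ p = 0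
    · simp [hi]
    · exact (mul_le_mul_left hlt.le _).trans (ENNReal.div_mul_cancel hi hc).le
  choose ρ hρ hadm hint using hex
  refine ⟨fun x => ⨆ i : ℕ × ℕ, (i.1 : ℝ≥0∞) * ρ i x, .iSup fun i => (hρ i).const_mul _, ?_, ?_⟩
  · calc ∫⁻ x, (⨆ i : ℕ × ℕ, (i.1 : ℝ≥0∞) * ρ i x) ^ p ∂ν
        ≤ ∫⁻ x, ∑' i : ℕ × ℕ, ((i.1 : ℝ≥0∞) * ρ i x) ^ p ∂ν := by
          refine lintegral_mono fun x => ?_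
          have := (ENNReal.orderIsoRpow p hp).map_iSup fun i : ℕ × ℕ => (i.1 : ℝ≥0∞) * ρ i x
          simp only [ENNReal.orderIsoRpow_apply] at this
          simp only [this]
          exact iSup_le fun i => ENNReal.le_tsum i
      _ = ∑' i : ℕ × ℕ, ∫⁻ x, ((i.1 : ℝ≥0∞) * ρ i x) ^ p ∂ν :=
          lintegral_tsum fun i => (((hρ i).const_mul _).pow_const p).aemeasurable
      _ ≤ ∑' i, ε i := ENNReal.tsum_le_tsum hint
      _ < ∞ := hsum.trans ENNReal.one_lt_top
  · intro k γ hγ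
    refine ENNReal.eq_top_of_forall_nnreal_le fun r => ?_
    obtain ⟨n, hn⟩ := exists_nat_ge r
    calc (r : ℝ≥0∞) ≤ (n : ℝ≥0∞) := by exact_mod_cast hn
      _ ≤ (n : ℝ≥0∞) * lineIntegral (ρ (n, k)) γ := le_mul_of_one_le_right' (hadm (n, k) γ hγ)
      _ = lineIntegral (fun x => (n : ℝ≥0∞) * ρ (n, k) x) γ := by
          rw [lineIntegral, lineIntegral, lintegral_const_mul'' _ (γ.aemeasurable_comp (hρ _))]
      _ ≤ _ := lineIntegral_mono (fun x => le_iSup (fun i : ℕ × ℕ => (i.1 : ℝ≥0∞) * ρ i x) (n, k)) γ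

/-- A `p`-weak upper gradient satisfies the upper gradient inequality on all curves on which some
fixed `L^p` function has finite line integral, and conversely. -/
lemma isWeakUpperGradient_iff (hp : 0 < p) {u : X → ℝ} {g : X → ℝ≥0∞} :
    IsWeakUpperGradient ν p u g ↔ Measurable g ∧ ∃ ρ : X → ℝ≥0∞, Measurable ρ ∧
      ∫⁻ x, ρ x ^ p ∂ν < ∞ ∧ ∀ γ : Curve X, lineIntegral ρ γ ≠ ∞ → UpperGradientIneq u g γ := by
  constructor
  · rintro ⟨hg, h⟩
    obtain ⟨ρ, hρ, hfin, H⟩ := exists_of_modulus_eq_zero hp (Γ := fun _ => _) fun _ => h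
    exact ⟨hg, ρ, hρ, hfin, fun γ hγ => by_contra fun hn => hγ (H 0 γ hn)⟩
  · rintro ⟨hg, ρ, hρ, hfin, H⟩
    exact ⟨hg, modulus_eq_zero_of hp hρ hfin fun γ hγ => by_contra fun hn => hγ (H γ hn)⟩

/-- Countably many `L^p` functions have finite line integrals on all curves on which some fixed
`L^p` function has. -/
lemma exists_dominating (hp : 0 < p) {σ : ℕ → X → ℝ≥0∞} (hσ : ∀ k, Measurable (σ k))
    (hfin : ∀ k, ∫⁻ x, σ k x ^ p ∂ν < ∞) :
    ∃ ρ : X → ℝ≥0∞, Measurable ρ ∧ ∫⁻ x, ρ x ^ p ∂ν < ∞ ∧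
      ∀ γ : Curve X, lineIntegral ρ γ ≠ ∞ → ∀ k, lineIntegral (σ k) γ ≠ ∞ := by
  obtain ⟨ρ, hρ, hρfin, H⟩ := exists_of_modulus_eq_zero (ν := ν) hp
    (Γ := fun k => {γ | lineIntegral (σ k) γ = ∞})
    fun k => modulus_eq_zero_of hp (hσ k) (hfin k) fun γ hγ => hγ
  exact ⟨ρ, hρ, hρfin, fun γ hγ k hk => hγ (H k γ hk)⟩

/-- `g` bounds the increments of `φ` on `[a, b]`. -/
def Controls (φ : ℝ → ℝ) (a b : ℝ) (g : ℝ → ℝ≥0∞) : Prop :=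
  AEMeasurable g (volume.restrict (Icc a b)) ∧ ∫⁻ t in Icc a b, g t ≠ ∞ ∧
    ∀ s t, a ≤ s → s ≤ t → t ≤ b → ENNReal.ofReal |φ t - φ s| ≤ ∫⁻ r in Icc s t, g r

/-- The function equal to `g₁` on `A` and to `g₂` off `A`. -/
def glue (A : Set ℝ) (g₁ g₂ : ℝ → ℝ≥0∞) : ℝ → ℝ≥0∞ :=
  fun t => A.indicator g₁ t + Aᶜ.indicator g₂ t

lemma glue_mem {A : Set ℝ} (g₁ g₂ : ℝ → ℝ≥0∞) {t : ℝ} (h : t ∈ A) :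
    glue A g₁ g₂ t = g₁ t := by simp [glue, h]

lemma glue_notMem {A : Set ℝ} (g₁ g₂ : ℝ → ℝ≥0∞) {t : ℝ} (h : t ∉ A) :
    glue A g₁ g₂ t = g₂ t := by simp [glue, h]

lemma glue_empty (g₁ g₂ : ℝ → ℝ≥0∞) : glue ∅ g₁ g₂ = g₂ := by
  funext t; simp [glue]

lemma glue_compl (A : Set ℝ) (g₁ g₂ : ℝ → ℝ≥0∞) : glue Aᶜ g₁ g₂ = glue A g₂ g₁ := by
  funext t; simp [glue, add_comm]

lemma controls_glue {φ : ℝ → ℝ} {a b : ℝ} {A : Set ℝ} (hA : MeasurableSet A) :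
    ∀ g₁ g₂ : ℝ → ℝ≥0∞, Controls φ a b g₁ → Controls φ a b g₂ →
      Controls φ a b (glue A g₁ g₂) := by
  have triv : ∀ (A : Set ℝ), MeasurableSet A → ∀ g₁ g₂ : ℝ → ℝ≥0∞, Controls φ a b g₁ →
      Controls φ a b g₂ → AEMeasurable (glue A g₁ g₂) (volume.restrict (Icc a b)) ∧
      ∫⁻ t in Icc a b, glue A g₁ g₂ t ≠ ∞ := by
    intro A hA g₁ g₂ h₁ h₂
    refine ⟨(h₁.1.indicator hA).add (h₂.1.indicator hA.compl), ne_top_of_le_ne_top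
      (ENNReal.add_ne_top.2 ⟨h₁.2.1, h₂.2.1⟩) ?_⟩
    rw [← lintegral_add_left' h₁.1]
    refine lintegral_mono fun t => ?_
    by_cases ht : t ∈ A <;> simp [glue, ht]
  rw [BorelSpace.measurable_eq (α := ℝ), borel_eq_generateFrom_Iio] at hA
  induction A, hA using MeasurableSpace.generateFrom_induction with
  | hC A hAC hAm =>
    obtain ⟨c, rfl⟩ := hAC
    intro g₁ g₂ h₁ h₂
    have := triv (Iio c) measurableSet_Iio g₁ g₂ h₁ h₂
    refine ⟨this.1, this.2, fun s t hs hst ht => ?_⟩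
    rcases le_or_gt c s with hcs | hsc
    · refine (h₂.2.2 s t hs hst ht).trans (le_of_eq (setLIntegral_congr_fun measurableSet_Icc ?_))
      intro r hr
      rw [glue_notMem _ _ (by simpa using hcs.trans hr.1)]
    rcases le_or_gt c t with hct | htc
    · have e : Icc s t = Ico s c ∪ Icc c t := (Ico_union_Icc_eq_Icc hsc.le hct).symm
      have e1 : ∫⁻ r in Ico s c, glue (Iio c) g₁ g₂ r = ∫⁻ r in Icc s c, g₁ r := by
        rw [setLIntegral_congr (Ico_ae_eq_Icc (a := s) (b := c)).symm]
        refine setLIntegral_congr_fun measurableSet_Ico fun r hr => ?_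
        rw [glue_mem (A := Iio c) _ _ hr.2]
      have e2 : ∫⁻ r in Icc c t, glue (Iio c) g₁ g₂ r = ∫⁻ r in Icc c t, g₂ r := by
        refine setLIntegral_congr_fun measurableSet_Icc fun r hr => ?_
        rw [glue_notMem _ _ (by simpa using hr.1)]
      rw [e, lintegral_union measurableSet_Icc, e1, e2]
      · refine le_trans ?_ (add_le_add (h₁.2.2 s c hs hsc.le (hct.trans ht))
          (h₂.2.2 c t (hs.trans hsc.le) hct ht))
        rw [← ENNReal.ofReal_add (abs_nonneg _) (abs_nonneg _)]
        refine ENNReal.ofReal_le_ofReal ?_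
        rw [add_comm]
        exact abs_sub_le _ _ _
      · rw [Set.disjoint_left]; intro r hr hr'; exact absurd hr.2 (not_lt.2 hr'.1)
    · refine (h₁.2.2 s t hs hst ht).trans (le_of_eq (setLIntegral_congr_fun measurableSet_Icc ?_))
      intro r hr
      rw [glue_mem (A := Iio c) _ _ (hr.2.trans_lt htc)]
  | empty => intro g₁ g₂ h₁ h₂; simpa [glue_empty] using h₂
  | compl A hA ih => intro g₁ g₂ h₁ h₂; simpa [glue_compl] using ih g₂ g₁ h₂ h₁
  | iUnion A hA ih =>
    intro g₁ g₂ h₁ h₂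
    rw [← borel_eq_generateFrom_Iio, ← BorelSpace.measurable_eq (α := ℝ)] at hA
    have := triv (⋃ i, A i) (.iUnion hA) g₁ g₂ h₁ h₂
    refine ⟨this.1, this.2, fun s t hs hst ht => ?_⟩
    have hfin : ∀ n : ℕ, Controls φ a b (glue (⋃ i < n, A i) g₁ g₂) := by
      intro n
      induction n with
      | zero => simpa [glue_empty] using h₂
      | succ n ihn =>
        have := ih n g₁ _ h₁ ihn
        convert this using 1
        funext r
        by_cases hr : r ∈ A n
        · rw [glue_mem _ _ hr, glue_mem]
          exact mem_iUnion₂.2 ⟨n, n.lt_succ_self, hr⟩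
        rw [glue_notMem (A := A n) _ _ hr]
        by_cases hr' : r ∈ ⋃ i < n, A i
        · obtain ⟨k, hk, hkr⟩ := mem_iUnion₂.1 hr'
          rw [glue_mem _ _ hr', glue_mem]
          exact mem_iUnion₂.2 ⟨k, hk.trans n.lt_succ_self, hkr⟩
        · rw [glue_notMem _ _ hr', glue_notMem]
          intro h
          obtain ⟨k, hk, hkr⟩ := mem_iUnion₂.1 h
          rcases Nat.lt_succ_iff_lt_or_eq.1 hk with hk | rfl
          · exact hr' (mem_iUnion₂.2 ⟨k, hk, hkr⟩)
          · exact hr hkr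
    have hsub : volume.restrict (Icc s t) ≤ (volume.restrict (Icc a b) : Measure ℝ) :=
      Measure.restrict_mono (Icc_subset_Icc hs ht) le_rfl
    refine ge_of_tendsto' (tendsto_lintegral_of_dominated_convergence'
      (F := fun n : ℕ => glue (⋃ i < n, A i) g₁ g₂) (fun r => g₁ r + g₂ r)
      (fun n => (hfin n).1.mono_measure hsub) (fun n => .of_forall fun r => ?_) ?_ (.of_forall ?_))
      fun n => (hfin n).2.2 s t hs hst ht
    · by_cases hr : r ∈ ⋃ i < n, A i
      · simp only [glue_mem _ _ hr]; exact le_self_add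
      · simp only [glue_notMem _ _ hr]; exact le_add_self
    · refine ne_top_of_le_ne_top (ENNReal.add_ne_top.2 ⟨h₁.2.1, h₂.2.1⟩) ?_
      rw [← lintegral_add_left' h₁.1]
      exact lintegral_mono' hsub le_rfl
    · intro r
      refine tendsto_const_nhds.congr' ?_
      by_cases hr : r ∈ ⋃ i, A i
      · obtain ⟨k, hk⟩ := mem_iUnion.1 hr
        filter_upwards [eventually_gt_atTop k] with n hn
        rw [glue_mem _ _ hr, glue_mem]
        exact mem_iUnion₂.2 ⟨k, hn, hk⟩
      · refine .of_forall fun n => ?_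
        dsimp only
        rw [glue_notMem _ _ hr, glue_notMem]
        intro h
        obtain ⟨k, -, hk⟩ := mem_iUnion₂.1 h
        exact hr (mem_iUnion.2 ⟨k, hk⟩)

/-- The minimum of two `p`-weak upper gradients in `L^p` is a `p`-weak upper gradient. -/
lemma IsWeakUpperGradient.min (hp : 0 < p) {u : X → ℝ} {g₁ g₂ : X → ℝ≥0∞}
    (h₁ : IsWeakUpperGradient ν p u g₁) (f₁ : ∫⁻ x, g₁ x ^ p ∂ν < ∞)
    (h₂ : IsWeakUpperGradient ν p u g₂) (f₂ : ∫⁻ x, g₂ x ^ p ∂ν < ∞) :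
    IsWeakUpperGradient ν p u (fun x => min (g₁ x) (g₂ x)) := by
  classical
  rw [isWeakUpperGradient_iff hp] at h₁ h₂ ⊢
  obtain ⟨m₁, ρ₁, hρ₁, k₁, H₁⟩ := h₁
  obtain ⟨m₂, ρ₂, hρ₂, k₂, H₂⟩ := h₂
  obtain ⟨ρ, hρ, hρfin, H⟩ := exists_dominating (ν := ν) hp
    (σ := fun n => match n with | 0 => g₁ | 1 => g₂ | 2 => ρ₁ | _ => ρ₂)
    (by rintro (_ | _ | _ | n) <;> assumption) (by rintro (_ | _ | _ | n) <;> assumption)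
  refine ⟨m₁.min m₂, ρ, hρ, hρfin, fun γ hγ => ?_⟩
  have hsub : ∀ (s t : ℝ) (hs : γ.a ≤ s) (hst : s ≤ t) (ht : t ≤ γ.b) (σ : X → ℝ≥0∞),
      lineIntegral σ γ ≠ ∞ → lineIntegral σ (γ.sub s t hs hst ht) ≠ ∞ := fun s t hs hst ht σ hσ =>
    ne_top_of_le_ne_top hσ (lintegral_mono_set (Icc_subset_Icc hs ht))
  have c₁ : Controls (fun t => u (γ.toFun t)) γ.a γ.b (fun t => g₁ (γ.toFun t)) :=
    ⟨γ.aemeasurable_comp m₁, H γ hγ 0, fun s t hs hst ht =>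
      H₁ (γ.sub s t hs hst ht) (hsub s t hs hst ht _ (H γ hγ 2))⟩
  have c₂ : Controls (fun t => u (γ.toFun t)) γ.a γ.b (fun t => g₂ (γ.toFun t)) :=
    ⟨γ.aemeasurable_comp m₂, H γ hγ 1, fun s t hs hst ht =>
      H₂ (γ.sub s t hs hst ht) (hsub s t hs hst ht _ (H γ hγ 3))⟩
  have hnull : NullMeasurableSet {t | g₁ (γ.toFun t) ≤ g₂ (γ.toFun t)}
      (volume.restrict (Icc γ.a γ.b)) := nullMeasurableSet_le c₁.1 c₂.1
  obtain ⟨A, hAsub, hA, hAe⟩ := hnull.exists_measurable_superset_ae_eq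
  refine ((controls_glue hA _ _ c₁ c₂).2.2 γ.a γ.b le_rfl γ.le le_rfl).trans
    (le_of_eq (lintegral_congr_ae ?_))
  filter_upwards [hAe] with t ht
  have ht : t ∈ A ↔ g₁ (γ.toFun t) ≤ g₂ (γ.toFun t) := iff_of_eq ht
  by_cases h : t ∈ A
  · rw [glue_mem _ _ h, min_eq_left (ht.1 h)]
  · rw [glue_notMem _ _ h, min_eq_right (not_le.1 (mt ht.2 h)).le]

/-- A decreasing limit of `p`-weak upper gradients in `L^p` is a `p`-weak upper gradient. -/
lemma IsWeakUpperGradient.iInf (hp : 0 < p) {u : X → ℝ} {g : ℕ → X → ℝ≥0∞} (hanti : Antitone g)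
    (h : ∀ n, IsWeakUpperGradient ν p u (g n)) (f : ∫⁻ x, g 0 x ^ p ∂ν < ∞) :
    IsWeakUpperGradient ν p u (fun x => ⨅ n, g n x) := by
  have hm : ∀ n, Measurable (g n) := fun n => (h n).1
  simp_rw [isWeakUpperGradient_iff hp] at h
  choose _ ρ hρ k H using h
  obtain ⟨ρ', hρ', hfin', H'⟩ := exists_dominating (ν := ν) hp
    (σ := fun n => match n with | 0 => g 0 | n + 1 => ρ n)
    (by rintro (_ | n); exacts [hm 0, hρ n]) (by rintro (_ | n); exacts [f, k n])
  rw [isWeakUpperGradient_iff hp]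
  refine ⟨.iInf hm, ρ', hρ', hfin', fun γ hγ => ?_⟩
  have hγm := γ.continuousOn.aemeasurable (μ := volume) measurableSet_Icc
  have hmap : ∀ σ : X → ℝ≥0∞, Measurable σ → lineIntegral σ γ =
      ∫⁻ x, σ x ∂(Measure.map γ.toFun (volume.restrict (Icc γ.a γ.b))) := fun σ hσ =>
    (lintegral_map' hσ.aemeasurable hγm).symm
  rw [UpperGradientIneq, hmap _ (.iInf hm), lintegral_iInf hm hanti]
  · refine le_iInf fun n => ?_
    rw [← hmap _ (hm n)]
    exact H n γ (H' γ hγ (n + 1))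
  · rw [← hmap _ (hm 0)]; exact H' γ hγ 0

lemma IsUpperGradient.isWeakUpperGradient (hp : 0 < p) {u : X → ℝ} {g : X → ℝ≥0∞}
    (h : IsUpperGradient u g) : IsWeakUpperGradient ν p u g :=
  (isWeakUpperGradient_iff hp).2 ⟨h.1, 0, measurable_zero, by simp [hp], fun γ _ => h.2 γ⟩

/-- Every function with a `p`-weak upper gradient in `L^p` has a minimal one. -/
theorem exists_isMinimalWeakUpperGradient (hp : 0 < p) {u : X → ℝ}
    (h : ∃ g, IsWeakUpperGradient ν p u g ∧ ∫⁻ x, g x ^ p ∂ν < ∞) :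
    ∃ g, IsMinimalWeakUpperGradient ν p u g := by
  set S : Set ℝ≥0∞ := (fun g : X → ℝ≥0∞ => ∫⁻ x, g x ^ p ∂ν) ''
    {g | IsWeakUpperGradient ν p u g ∧ ∫⁻ x, g x ^ p ∂ν < ∞}
  obtain ⟨v, -, hv, hvS⟩ := exists_seq_tendsto_sInf (S := S) (Set.Nonempty.image _ h)
    (OrderBot.bddBelow S)
  choose g hg hgv using hvS
  let m : ℕ → X → ℝ≥0∞ := fun n => Nat.rec (g 0) (fun k f x => min (f x) (g (k + 1) x)) n
  have hmono : ∀ {f₁ f₂ : X → ℝ≥0∞}, (∀ x, f₁ x ≤ f₂ x) →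
      ∫⁻ x, f₁ x ^ p ∂ν ≤ ∫⁻ x, f₂ x ^ p ∂ν := fun h =>
    lintegral_mono fun x => ENNReal.rpow_le_rpow (h x) hp.le
  have hmg : ∀ n x, m n x ≤ g n x := by
    rintro (_ | n) x
    exacts [le_rfl, min_le_right _ _]
  have hmfin : ∀ n, ∫⁻ x, m n x ^ p ∂ν < ∞ := fun n => (hmono (hmg n)).trans_lt (hg n).2
  have hmw : ∀ n, IsWeakUpperGradient ν p u (m n) := by
    intro n
    induction n with
    | zero => exact (hg 0).1
    | succ n ih => exact ih.min hp (hmfin n) (hg (n + 1)).1 (hg (n + 1)).2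
  have hanti : Antitone m := antitone_nat_of_succ_le fun n x => min_le_left _ _
  set G : X → ℝ≥0∞ := fun x => ⨅ n, m n x
  have hG : IsWeakUpperGradient ν p u G := .iInf hp hanti hmw (hmfin 0)
  have hGle : ∫⁻ x, G x ^ p ∂ν ≤ sInf S := by
    refine ge_of_tendsto' hv fun n => ?_
    rw [← hgv n]
    exact hmono fun x => (iInf_le _ n).trans (hmg n x)
  have hGfin : ∫⁻ x, G x ^ p ∂ν < ∞ := (hmono fun x => iInf_le _ 0).trans_lt (hmfin 0)
  refine ⟨G, hG, hGfin, fun g' hg' hfin' => ?_⟩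
  have hle : ∫⁻ x, min (G x) (g' x) ^ p ∂ν ≤ ∫⁻ x, G x ^ p ∂ν := hmono fun x => min_le_left _ _
  have hmin := hG.min hp hGfin hg' hfin'
  have heq := ae_eq_of_ae_le_of_lintegral_le (μ := ν) (f := fun x => min (G x) (g' x) ^ p)
    (g := fun x => G x ^ p)
    (.of_forall fun x => ENNReal.rpow_le_rpow (min_le_left _ _) hp.le)
    (hle.trans_lt hGfin).ne (hG.1.pow_const p).aemeasurable
    (hGle.trans (sInf_le ⟨_, ⟨hmin, hle.trans_lt hGfin⟩, rfl⟩))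
  filter_upwards [heq] with x hx
  have := ENNReal.rpow_left_injective hp.ne' hx
  exact (min_eq_left_iff.1 this)

/-- A function in `D^{1,p}` vanishing `ν`-a.e. has `0` as a `p`-weak upper gradient. -/
lemma isWeakUpperGradient_zero_of_ae_eq_zero (hp : 0 < p) {u : X → ℝ} (hu : Measurable u)
    {g : X → ℝ≥0∞} (hg : IsUpperGradient u g) (hfin : ∫⁻ x, g x ^ p ∂ν < ∞)
    (h0 : u =ᵐ[ν] 0) : IsWeakUpperGradient ν p u 0 := by
  set E : Set X := {x | u x ≠ 0}
  have hE : MeasurableSet E := hu (measurableSet_singleton 0).compl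
  set σ : X → ℝ≥0∞ := E.indicator fun _ => ∞
  have hσ : Measurable σ := measurable_const.indicator hE
  have hσfin : ∫⁻ x, σ x ^ p ∂ν < ∞ := by
    rw [(lintegral_eq_zero_iff (hσ.pow_const p)).2]
    · simp
    · filter_upwards [h0] with x hx
      simp [σ, E, hx, hp]
  obtain ⟨ρ, hρ, hρfin, H⟩ := exists_dominating (ν := ν) hp
    (σ := fun n => match n with | 0 => g | _ => σ)
    (by rintro (_ | n); exacts [hg.1, hσ]) (by rintro (_ | n); exacts [hfin, hσfin])
  refine (isWeakUpperGradient_iff hp).2 ⟨measurable_zero, ρ, hρ, hρfin, fun γ hγ => ?_⟩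
  have hgγ : ∫⁻ t in Icc γ.a γ.b, g (γ.toFun t) ≠ ∞ := H γ hγ 0
  have hz : ∀ᵐ t ∂(volume.restrict (Icc γ.a γ.b)), u (γ.toFun t) = 0 := by
    have := ae_lt_top' (γ.aemeasurable_comp hσ) (H γ hγ 1)
    filter_upwards [this] with t ht
    by_contra hne
    simp [σ, E, hne] at ht
  rcases γ.le.eq_or_lt with hab | hab
  · simp [UpperGradientIneq, hab]
  -- every interval of positive length meets the zero set
  have hmeet : ∀ s t, γ.a ≤ s → s < t → t ≤ γ.b → ∃ r ∈ Icc s t, u (γ.toFun r) = 0 := by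
    intro s t hs hst ht
    by_contra! hcon
    have h1 : ∀ᵐ r ∂(volume.restrict (Icc s t)), u (γ.toFun r) = 0 :=
      ae_mono (Measure.restrict_mono (Icc_subset_Icc hs ht) le_rfl) hz
    have h2 : ∀ᵐ r ∂(volume.restrict (Icc s t)), False := by
      filter_upwards [h1, ae_restrict_mem measurableSet_Icc] with r hr hr'
      exact hcon r hr' hr
    have h3 : volume (Icc s t) = 0 := by
      rw [ae_iff] at h2
      simpa only [not_false_eq_true, ofPred_true, Measure.restrict_apply_univ] using h2
    rw [Real.volume_Icc, ENNReal.ofReal_eq_zero] at h3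
    linarith
  have hsmall : ∀ ε : ℝ≥0∞, ε ≠ 0 → ∃ δ > 0, ∀ s t, γ.a ≤ s → t ≤ γ.b → t - s < δ →
      ∫⁻ r in Icc s t, g (γ.toFun r) < ε := by
    intro ε hε
    obtain ⟨δ, hδ, hδ'⟩ := exists_pos_setLIntegral_lt_of_measure_lt hgγ hε
    obtain ⟨δ', hδ0, hδ1⟩ := ENNReal.lt_iff_exists_real_btwn.1 hδ
    refine ⟨δ', by simpa using hδ1.1, fun s t hs ht hst => ?_⟩
    have := hδ' (Icc s t) (by
      refine (Measure.restrict_apply_le _ _).trans_lt (lt_of_le_of_lt ?_ hδ1.2)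
      rw [Real.volume_Icc]
      exact ENNReal.ofReal_le_ofReal hst.le)
    rwa [Measure.restrict_restrict measurableSet_Icc,
      inter_eq_left.2 (Icc_subset_Icc hs ht)] at this
  have hval : ∀ (s t : ℝ) (hs : γ.a ≤ s) (hst : s ≤ t) (ht : t ≤ γ.b),
      ENNReal.ofReal |u (γ.toFun t) - u (γ.toFun s)| ≤ ∫⁻ r in Icc s t, g (γ.toFun r) :=
    fun s t hs hst ht => hg.2 (γ.sub s t hs hst ht)
  have ha : u (γ.toFun γ.a) = 0 := by
    by_contra hne
    obtain ⟨δ, hδ, H⟩ := hsmall (ENNReal.ofReal |u (γ.toFun γ.a)|) (by simpa using hne)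
    obtain ⟨r, hr, hr0⟩ := hmeet γ.a (min γ.b (γ.a + δ / 2)) le_rfl
      (lt_min hab (by linarith)) (min_le_left _ _)
    have hrb := le_min_iff.1 hr.2
    have h1 := hval γ.a r le_rfl hr.1 hrb.1
    rw [hr0, zero_sub, abs_neg] at h1
    exact absurd (h1.trans_lt (H γ.a r le_rfl hrb.1 (by linarith [hrb.2]))) (lt_irrefl _)
  have hb : u (γ.toFun γ.b) = 0 := by
    by_contra hne
    obtain ⟨δ, hδ, H⟩ := hsmall (ENNReal.ofReal |u (γ.toFun γ.b)|) (by simpa using hne)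
    obtain ⟨r, hr, hr0⟩ := hmeet (max γ.a (γ.b - δ / 2)) γ.b (le_max_left _ _)
      (max_lt hab (by linarith)) le_rfl
    have hra := max_le_iff.1 hr.1
    have h1 := hval r γ.b hra.1 hr.2 le_rfl
    rw [hr0, sub_zero] at h1
    exact absurd (h1.trans_lt (H r γ.b hra.1 le_rfl (by linarith [hra.2]))) (lt_irrefl _)
  simp [UpperGradientIneq, ha, hb]

end Curves

/-! ### Sobolev functions and the cotangent module -/

section Modules

variable {X : Type*} [MetricSpace X] [MeasurableSpace X] [BorelSpace X]

instance fact_one_le_ofReal (p : ℝ) [hp : Fact (1 < p)] : Fact (1 ≤ ENNReal.ofReal p) :=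
  ⟨by simpa using hp.out.le⟩

/-- The Sobolev-Dirichlet class `D^{1,p}(X)`: Borel functions with an upper gradient in `L^p`. -/
def D1p (ν : Measure X) (p : ℝ) [hp : Fact (1 < p)] : Submodule ℝ (X → ℝ) where
  carrier := {u | Measurable u ∧ ∃ g, IsUpperGradient u g ∧ ∫⁻ x, g x ^ p ∂ν < ∞}
  zero_mem' := ⟨measurable_zero, 0, ⟨measurable_zero, fun γ => by simp [UpperGradientIneq]⟩,
    by simp [zero_lt_one.trans hp.out]⟩
  add_mem' := by
    rintro u v ⟨hu, g, hg, hgf⟩ ⟨hv, h, hh, hhf⟩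
    refine ⟨hu.add hv, g + h, ⟨hg.1.add hh.1, fun γ => ?_⟩,
      ENNReal.lintegral_rpow_add_lt_top_of_lintegral_rpow_lt_top hg.1.aemeasurable hgf hhf
        hp.out.le⟩
    have e : lineIntegral (g + h) γ = lineIntegral g γ + lineIntegral h γ :=
      lintegral_add_left' (γ.aemeasurable_comp hg.1) _
    rw [UpperGradientIneq, e]
    refine le_trans ?_ (add_le_add (hg.2 γ) (hh.2 γ))
    rw [← ENNReal.ofReal_add (abs_nonneg _) (abs_nonneg _)]
    refine ENNReal.ofReal_le_ofReal ?_
    rw [Pi.add_apply, Pi.add_apply, add_sub_add_comm]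
    exact abs_add_le _ _
  smul_mem' := by
    rintro c u ⟨hu, g, hg, hgf⟩
    refine ⟨hu.const_smul c, fun x => ENNReal.ofReal |c| * g x, ⟨hg.1.const_mul _, fun γ => ?_⟩, ?_⟩
    · rw [UpperGradientIneq, lineIntegral, lintegral_const_mul'' _ (γ.aemeasurable_comp hg.1)]
      refine le_trans (le_of_eq ?_) (mul_le_mul_right (hg.2 γ) _)
      rw [← ENNReal.ofReal_mul (abs_nonneg _), ← abs_mul, mul_sub]
      rfl
    · have h0 : 0 ≤ p := zero_le_one.trans hp.out.le
      simp_rw [ENNReal.mul_rpow_of_nonneg _ _ h0]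
      rw [lintegral_const_mul _ (hg.1.pow_const p)]
      exact ENNReal.mul_lt_top (ENNReal.rpow_lt_top_of_nonneg h0 ENNReal.ofReal_ne_top) hgf

variable {ν : Measure X} {p : ℝ} [hp : Fact (1 < p)]

lemma exists_minGrad (f : D1p ν p) : ∃ g, IsMinimalWeakUpperGradient ν p (f : X → ℝ) g := by
  have h0 : 0 < p := zero_lt_one.trans hp.out
  obtain ⟨-, g, hg, hfin⟩ := f.2
  exact exists_isMinimalWeakUpperGradient h0 ⟨g, hg.isWeakUpperGradient h0, hfin⟩

/-- The minimal `p`-weak upper gradient of `f ∈ D^{1,p}(X)`, as a `[0,∞]`-valued function. -/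
def minGrad (f : D1p ν p) : X → ℝ≥0∞ := (exists_minGrad f).choose

lemma minGrad_spec (f : D1p ν p) : IsMinimalWeakUpperGradient ν p (f : X → ℝ) (minGrad f) :=
  (exists_minGrad f).choose_spec

/-- The minimal `p`-weak upper gradient `|Df|` of `f ∈ D^{1,p}(X)` (which is finite `ν`-a.e.). -/
def gradNorm (f : D1p ν p) (x : X) : ℝ := (minGrad f x).toReal

lemma minGrad_lt_top (f : D1p ν p) : ∀ᵐ x ∂ν, minGrad f x < ∞ := by
  have h0 : 0 < p := zero_lt_one.trans hp.out
  have h := minGrad_spec f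
  filter_upwards [ae_lt_top (h.1.1.pow_const p) h.2.1.ne] with x hx
  exact (ENNReal.rpow_lt_top_iff_of_pos h0).1 hx

lemma gradNorm_nonneg (f : D1p ν p) (x : X) : 0 ≤ gradNorm f x := ENNReal.toReal_nonneg

lemma measurable_gradNorm (f : D1p ν p) : Measurable (gradNorm f) :=
  (minGrad_spec f).1.1.ennreal_toReal

lemma memLp_gradNorm (f : D1p ν p) : MemLp (gradNorm f) (ENNReal.ofReal p) ν := by
  have h0 : 0 < p := zero_lt_one.trans hp.out
  refine ⟨(measurable_gradNorm f).aestronglyMeasurable, ?_⟩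
  rw [eLpNorm_lt_top_iff_lintegral_rpow_enorm_lt_top (by simpa using h0) ENNReal.ofReal_ne_top,
    ENNReal.toReal_ofReal h0.le]
  refine lt_of_le_of_lt (lintegral_mono fun x => ENNReal.rpow_le_rpow ?_ h0.le) (minGrad_spec f).2.1
  rw [gradNorm, Real.enorm_of_nonneg ENNReal.toReal_nonneg]
  exact ENNReal.ofReal_toReal_le

lemma gradNorm_add (f g : D1p ν p) :
    ∀ᵐ x ∂ν, gradNorm (f + g) x ≤ gradNorm f x + gradNorm g x := by
  have h0 : 0 < p := zero_lt_one.trans hp.out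
  have hf := minGrad_spec f
  have hg := minGrad_spec g
  have hle : minGrad (f + g) ≤ᵐ[ν] minGrad f + minGrad g := by
    refine (minGrad_spec (f + g)).2.2 _ ?_
      (ENNReal.lintegral_rpow_add_lt_top_of_lintegral_rpow_lt_top hf.1.1.aemeasurable hf.2.1 hg.2.1
        hp.out.le)
    obtain ⟨-, ρ₁, hρ₁, k₁, H₁⟩ := (isWeakUpperGradient_iff h0).1 hf.1
    obtain ⟨-, ρ₂, hρ₂, k₂, H₂⟩ := (isWeakUpperGradient_iff h0).1 hg.1
    obtain ⟨ρ, hρ, hρfin, H⟩ := exists_dominating (ν := ν) h0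
      (σ := fun n => match n with | 0 => ρ₁ | _ => ρ₂)
      (by rintro (_ | n) <;> assumption) (by rintro (_ | n) <;> assumption)
    refine (isWeakUpperGradient_iff h0).2 ⟨hf.1.1.add hg.1.1, ρ, hρ, hρfin, fun γ hγ => ?_⟩
    have e : lineIntegral (minGrad f + minGrad g) γ =
        lineIntegral (minGrad f) γ + lineIntegral (minGrad g) γ :=
      lintegral_add_left' (γ.aemeasurable_comp hf.1.1) _
    rw [UpperGradientIneq, e]
    refine le_trans ?_ (add_le_add (H₁ γ (H γ hγ 0)) (H₂ γ (H γ hγ 1)))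
    rw [← ENNReal.ofReal_add (abs_nonneg _) (abs_nonneg _)]
    refine ENNReal.ofReal_le_ofReal ?_
    rw [Submodule.coe_add, Pi.add_apply, Pi.add_apply, add_sub_add_comm]
    exact abs_add_le _ _
  filter_upwards [hle, minGrad_lt_top f, minGrad_lt_top g] with x hx h1 h2
  rw [gradNorm, gradNorm, gradNorm, ← ENNReal.toReal_add h1.ne h2.ne]
  exact ENNReal.toReal_mono (ENNReal.add_lt_top.2 ⟨h1, h2⟩).ne hx

lemma gradNorm_smul_le (c : ℝ) (f : D1p ν p) :
    ∀ᵐ x ∂ν, gradNorm (c • f) x ≤ |c| * gradNorm f x := by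
  have h0 : 0 < p := zero_lt_one.trans hp.out
  have hf := minGrad_spec f
  have hle : minGrad (c • f) ≤ᵐ[ν] fun x => ENNReal.ofReal |c| * minGrad f x := by
    refine (minGrad_spec (c • f)).2.2 _ ?_ ?_
    · obtain ⟨-, ρ, hρ, k, H⟩ := (isWeakUpperGradient_iff h0).1 hf.1
      refine (isWeakUpperGradient_iff h0).2 ⟨hf.1.1.const_mul _, ρ, hρ, k, fun γ hγ => ?_⟩
      rw [UpperGradientIneq, lineIntegral, lintegral_const_mul'' _ (γ.aemeasurable_comp hf.1.1)]
      refine le_trans (le_of_eq ?_) (mul_le_mul_right (H γ hγ) _)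
      rw [← ENNReal.ofReal_mul (abs_nonneg _), ← abs_mul, mul_sub]
      rfl
    · simp_rw [ENNReal.mul_rpow_of_nonneg _ _ h0.le]
      rw [lintegral_const_mul _ (hf.1.1.pow_const p)]
      exact ENNReal.mul_lt_top (ENNReal.rpow_lt_top_of_nonneg h0.le ENNReal.ofReal_ne_top) hf.2.1
  filter_upwards [hle, minGrad_lt_top f] with x hx h1
  have := ENNReal.toReal_mono (ENNReal.mul_lt_top ENNReal.ofReal_lt_top h1).ne hx
  rwa [ENNReal.toReal_mul, ENNReal.toReal_ofReal (abs_nonneg _)] at this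

lemma gradNorm_smul (c : ℝ) (f : D1p ν p) :
    ∀ᵐ x ∂ν, gradNorm (c • f) x = |c| * gradNorm f x := by
  rcases eq_or_ne c 0 with rfl | hc
  · filter_upwards [gradNorm_smul_le 0 f] with x hx
    refine le_antisymm hx ?_
    simpa using gradNorm_nonneg _ x
  · have h := gradNorm_smul_le c⁻¹ (c • f)
    rw [inv_smul_smul₀ hc] at h
    filter_upwards [gradNorm_smul_le c f, h] with x h1 h2
    refine le_antisymm h1 ?_
    have := mul_le_mul_of_nonneg_left h2 (abs_nonneg c)
    rwa [← mul_assoc, ← abs_mul, mul_inv_cancel₀ hc, abs_one, one_mul] at this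

lemma gradNorm_eq_zero_of_ae_eq_zero (f : D1p ν p) (h : (f : X → ℝ) =ᵐ[ν] 0) :
    gradNorm f =ᵐ[ν] 0 := by
  have h0 : 0 < p := zero_lt_one.trans hp.out
  obtain ⟨hm, g, hg, hfin⟩ := f.2
  have := (minGrad_spec f).2.2 0 (isWeakUpperGradient_zero_of_ae_eq_zero h0 hm hg hfin h)
    (by simp [h0])
  filter_upwards [this] with x hx
  have : minGrad f x = 0 := le_antisymm hx bot_le
  simp [gradNorm, this]

/-- Maps that are constant on each piece of a countable Borel partition. -/
def PiecewiseConst {β : Type*} (ω : X → β) : Prop :=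
  (range ω).Countable ∧ ∀ s : Set β, MeasurableSet (ω ⁻¹' s)

lemma PiecewiseConst.comp {β β' : Type*} {ω : X → β} (h : PiecewiseConst ω) (φ : β → β') :
    PiecewiseConst fun x => φ (ω x) := by
  refine ⟨?_, fun s => h.2 (φ ⁻¹' s)⟩
  have : range (fun x => φ (ω x)) = φ '' range ω := range_comp φ ω
  rw [this]
  exact h.1.image _

lemma PiecewiseConst.prodMk {β β' : Type*} {ω : X → β} {ω' : X → β'} (h : PiecewiseConst ω)
    (h' : PiecewiseConst ω') : PiecewiseConst fun x => (ω x, ω' x) := by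
  have hc := h.1.prod h'.1
  refine ⟨hc.mono (by rintro _ ⟨x, rfl⟩; exact ⟨⟨x, rfl⟩, ⟨x, rfl⟩⟩), fun s => ?_⟩
  have : (fun x => (ω x, ω' x)) ⁻¹' s =
      ⋃ b ∈ (range ω ×ˢ range ω') ∩ s, (ω ⁻¹' {b.1} ∩ ω' ⁻¹' {b.2}) := by
    ext x
    simp only [mem_preimage, mem_iUnion, mem_inter_iff, mem_singleton_iff, exists_prop]
    constructor
    · intro hx
      exact ⟨(ω x, ω' x), ⟨⟨⟨x, rfl⟩, ⟨x, rfl⟩⟩, hx⟩, rfl, rfl⟩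
    · rintro ⟨⟨b, b'⟩, ⟨-, hs⟩, rfl, rfl⟩
      exact hs
  rw [this]
  exact .biUnion (hc.mono inter_subset_left) fun b _ => (h.2 _).inter (h'.2 _)

lemma PiecewiseConst.const {β : Type*} (b : β) : PiecewiseConst fun _ : X => b :=
  ⟨(countable_singleton b).mono (range_subset_iff.2 fun _ => mem_singleton b), fun s => by
    by_cases h : b ∈ s <;> simp [h]⟩

lemma PiecewiseConst.ae {β : Type*} {ω : X → β} (h : PiecewiseConst ω) {P : β → X → Prop}
    (hP : ∀ b, ∀ᵐ x ∂ν, P b x) : ∀ᵐ x ∂ν, P (ω x) x := by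
  have := (ae_ball_iff h.1).2 fun b _ => hP b
  filter_upwards [this] with x hx
  exact hx _ ⟨x, rfl⟩

/-- The pointwise norm of `ω = {(f_i, A_i)}`, encoded as the map equal to `f_i` on `A_i`:
it is `|Df_i|` on `A_i`. -/
def pcmNorm (ω : X → D1p ν p) (x : X) : ℝ := gradNorm (ω x) x

lemma pcmNorm_nonneg (ω : X → D1p ν p) (x : X) : 0 ≤ pcmNorm ω x := gradNorm_nonneg _ x

lemma measurable_pcmNorm {ω : X → D1p ν p} (h : PiecewiseConst ω) : Measurable (pcmNorm ω) := by
  intro s hs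
  have : pcmNorm ω ⁻¹' s = ⋃ f ∈ range ω, (ω ⁻¹' {f} ∩ gradNorm f ⁻¹' s) := by
    ext x
    simp only [pcmNorm, mem_preimage, mem_iUnion, mem_inter_iff, mem_singleton_iff, exists_prop]
    constructor
    · intro hx; exact ⟨ω x, ⟨x, rfl⟩, rfl, hx⟩
    · rintro ⟨f, -, rfl, hx⟩; exact hx
  rw [this]
  exact .biUnion h.1 fun f _ => (h.2 _).inter (measurable_gradNorm f hs)

lemma pcmNorm_add {ω ω' : X → D1p ν p} (h : PiecewiseConst ω) (h' : PiecewiseConst ω') :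
    ∀ᵐ x ∂ν, pcmNorm (ω + ω') x ≤ pcmNorm ω x + pcmNorm ω' x :=
  (h.prodMk h').ae (P := fun b x => gradNorm (b.1 + b.2) x ≤ gradNorm b.1 x + gradNorm b.2 x)
    fun b => gradNorm_add b.1 b.2

lemma pcmNorm_mul {s : X → ℝ} {ω : X → D1p ν p} (hs : PiecewiseConst s) (h : PiecewiseConst ω) :
    ∀ᵐ x ∂ν, pcmNorm (fun x => s x • ω x) x = |s x| * pcmNorm ω x :=
  (hs.prodMk h).ae (P := fun b x => gradNorm (b.1 • b.2) x = |b.1| * gradNorm b.2 x)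
    fun b => gradNorm_smul b.1 b.2

/-- The families `{(f_i, A_i)}` of the pre-cotangent module, where `(A_i)` is a countable Borel
partition, `f_i ∈ D^{1,p}(X)` and `∑ ∫_{A_i} |Df_i|^p dν < ∞`. Such a family is encoded as the map
`X → D^{1,p}(X)` that equals `f_i` on `A_i`; sums are then taken on the common refinement. -/
def pcmSubmodule (ν : Measure X) (p : ℝ) [hp : Fact (1 < p)] : Submodule ℝ (X → D1p ν p) where
  carrier := {ω | PiecewiseConst ω ∧ MemLp (pcmNorm ω) (ENNReal.ofReal p) ν}
  zero_mem' := ⟨.const 0, memLp_gradNorm 0⟩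
  add_mem' := by
    rintro ω ω' ⟨h, hL⟩ ⟨h', hL'⟩
    have hc : PiecewiseConst (ω + ω') := (h.prodMk h').comp fun b => b.1 + b.2
    refine ⟨hc, (hL.add hL').of_le (measurable_pcmNorm hc).aestronglyMeasurable ?_⟩
    filter_upwards [pcmNorm_add h h'] with x hx
    rw [Real.norm_of_nonneg (pcmNorm_nonneg _ x)]
    exact hx.trans (le_abs_self _)
  smul_mem' := by
    rintro c ω ⟨h, hL⟩
    have hc : PiecewiseConst (c • ω) := h.comp fun b => c • b
    refine ⟨hc, (hL.const_mul c).of_le (measurable_pcmNorm hc).aestronglyMeasurable ?_⟩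
    filter_upwards [pcmNorm_mul (.const c) h] with x hx
    have hx : pcmNorm (c • ω) x = |c| * pcmNorm ω x := hx
    rw [hx, norm_mul, norm_mul, Real.norm_eq_abs, abs_abs, Real.norm_eq_abs c]

/-- The pre-cotangent module `PCM_p`. -/
def PCM (ν : Measure X) (p : ℝ) [Fact (1 < p)] : Type _ := pcmSubmodule ν p

instance : AddCommGroup (PCM ν p) := inferInstanceAs (AddCommGroup (pcmSubmodule ν p))
instance : Module ℝ (PCM ν p) := inferInstanceAs (Module ℝ (pcmSubmodule ν p))

/-- The map `X → D^{1,p}(X)` underlying an element of `PCM_p`. -/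
def PCM.fn (ω : PCM ν p) : X → D1p ν p := Subtype.val (show pcmSubmodule ν p from ω)

/-- The element of `PCM_p` given by a map `X → D^{1,p}(X)`. -/
def PCM.mk (ω : X → D1p ν p) (h : PiecewiseConst ω)
    (hL : MemLp (pcmNorm ω) (ENNReal.ofReal p) ν) : PCM ν p :=
  show pcmSubmodule ν p from ⟨ω, h, hL⟩

lemma PCM.fn_mk (ω : X → D1p ν p) (h : PiecewiseConst ω)
    (hL : MemLp (pcmNorm ω) (ENNReal.ofReal p) ν) : (PCM.mk ω h hL).fn = ω := rfl

lemma PCM.ext {ω ω' : PCM ν p} (h : ω.fn = ω'.fn) : ω = ω' := Subtype.ext h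

lemma PCM.pc (ω : PCM ν p) : PiecewiseConst ω.fn := (show pcmSubmodule ν p from ω).2.1

lemma PCM.memLp (ω : PCM ν p) : MemLp (pcmNorm ω.fn) (ENNReal.ofReal p) ν :=
  (show pcmSubmodule ν p from ω).2.2

lemma PCM.fn_add (ω ω' : PCM ν p) : (ω + ω').fn = ω.fn + ω'.fn := rfl

lemma PCM.fn_sub (ω ω' : PCM ν p) : (ω - ω').fn = ω.fn - ω'.fn := rfl

lemma PCM.fn_neg (ω : PCM ν p) : (-ω).fn = -ω.fn := rfl

lemma PCM.fn_smul (c : ℝ) (ω : PCM ν p) : (c • ω).fn = c • ω.fn := rfl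

/-- The seminorm `(∑ ∫_{A_i} |Df_i|^p dν)^{1/p}` on `PCM_p`. -/
instance : Norm (PCM ν p) := ⟨fun ω => (eLpNorm (pcmNorm ω.fn) (ENNReal.ofReal p) ν).toReal⟩

lemma PCM.norm_def (ω : PCM ν p) : ‖ω‖ = (eLpNorm (pcmNorm ω.fn) (ENNReal.ofReal p) ν).toReal := rfl

lemma PCM.norm_le_of_ae {ω ω' : PCM ν p} {c : ℝ} (hc : 0 ≤ c)
    (h : ∀ᵐ x ∂ν, pcmNorm ω.fn x ≤ c * pcmNorm ω'.fn x) : ‖ω‖ ≤ c * ‖ω'‖ := by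
  rw [norm_def, norm_def, ← ENNReal.toReal_ofReal hc, ← ENNReal.toReal_mul]
  refine ENNReal.toReal_mono (ENNReal.mul_lt_top ENNReal.ofReal_lt_top ω'.memLp.2).ne ?_
  refine eLpNorm_le_mul_eLpNorm_of_ae_le_mul ?_ _
  filter_upwards [h] with x hx
  rwa [Real.norm_of_nonneg (pcmNorm_nonneg _ x), Real.norm_of_nonneg (pcmNorm_nonneg _ x)]

lemma PCM.core : SeminormedSpace.Core ℝ (PCM ν p) where
  norm_nonneg _ := ENNReal.toReal_nonneg
  norm_smul c ω := by
    have h := pcmNorm_mul (ν := ν) (p := p) (.const c) ω.pc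
    rw [PCM.norm_def, PCM.norm_def, ← toReal_enorm, ← ENNReal.toReal_mul]
    rw [← eLpNorm_const_smul]
    congr 1
    refine eLpNorm_congr_norm_ae ?_
    filter_upwards [h] with x hx
    have hx : pcmNorm (c • ω).fn x = |c| * pcmNorm ω.fn x := hx
    simp [hx]
  norm_triangle ω ω' := by
    rw [PCM.norm_def, PCM.norm_def, PCM.norm_def, ← ENNReal.toReal_add ω.memLp.2.ne ω'.memLp.2.ne]
    refine ENNReal.toReal_mono (ENNReal.add_lt_top.2 ⟨ω.memLp.2, ω'.memLp.2⟩).ne ?_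
    refine le_trans (eLpNorm_mono_ae_real ?_)
      (eLpNorm_add_le ω.memLp.1 ω'.memLp.1 (fact_one_le_ofReal p).out)
    filter_upwards [pcmNorm_add ω.pc ω'.pc] with x hx
    rw [Real.norm_of_nonneg (pcmNorm_nonneg _ x)]
    exact hx

instance : SeminormedAddCommGroup (PCM ν p) := SeminormedAddCommGroup.ofCore PCM.core
instance : NormedSpace ℝ (PCM ν p) := ⟨fun c ω => (PCM.core.norm_smul c ω).le⟩

/-- The cotangent module `L^p(T^*X)`: the completion of `PCM_p / ∼` (elements at distance zero are
identified). -/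
abbrev Cotangent (ν : Measure X) (p : ℝ) [Fact (1 < p)] : Type _ :=
  UniformSpace.Completion (PCM ν p)

/-- The pointwise norm on `PCM_p` as an element of `L^p`. -/
def PCM.ptNorm (ω : PCM ν p) : Lp ℝ (ENNReal.ofReal p) ν := ω.memLp.toLp _

lemma PCM.lipschitz_ptNorm : LipschitzWith 1 (PCM.ptNorm (ν := ν) (p := p)) := by
  refine LipschitzWith.of_dist_le_mul fun ω ω' => ?_
  rw [NNReal.coe_one, one_mul, dist_eq_norm, dist_eq_norm, PCM.ptNorm, PCM.ptNorm,
    ← MemLp.toLp_sub, Lp.norm_toLp, PCM.norm_def]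
  refine ENNReal.toReal_mono (ω - ω').memLp.2.ne (eLpNorm_mono_ae ?_)
  have h1 := pcmNorm_add (ω - ω').pc ω'.pc
  have h2 := pcmNorm_add (-(ω - ω')).pc ω.pc
  have h3 := pcmNorm_mul (ν := ν) (p := p) (.const (-1)) (ω - ω').pc
  filter_upwards [h1, h2, h3] with x h1 h2 h3
  have e1 : (ω - ω').fn + ω'.fn = ω.fn := congrArg PCM.fn (sub_add_cancel ω ω')
  have e2 : (-(ω - ω')).fn + ω.fn = ω'.fn :=
    congrArg PCM.fn (show -(ω - ω') + ω = ω' by abel)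
  have e3 : (fun x => (-1 : ℝ) • (ω - ω').fn x) = (-(ω - ω')).fn := by
    funext x
    exact neg_one_smul ℝ ((ω - ω').fn x)
  rw [e1] at h1
  rw [e2] at h2
  rw [e3] at h3
  rw [h3, abs_neg, abs_one, one_mul] at h2
  rw [Real.norm_of_nonneg (pcmNorm_nonneg _ x),
    Real.norm_eq_abs, Pi.sub_apply]
  exact abs_le.2 ⟨by linarith, by linarith⟩

/-- The pointwise norm `|v|_*` on the cotangent module, the continuous extension of the pointwise
norm on `PCM_p`. -/
def Cotangent.ptNorm : Cotangent ν p → Lp ℝ (ENNReal.ofReal p) ν :=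
  UniformSpace.Completion.extension PCM.ptNorm

lemma Cotangent.ptNorm_coe (ω : PCM ν p) :
    Cotangent.ptNorm (ω : Cotangent ν p) = PCM.ptNorm ω :=
  UniformSpace.Completion.extension_coe PCM.lipschitz_ptNorm.uniformContinuous ω

/-- Multiplication of elements of `PCM_p` by a bounded piecewise constant function. -/
def PCM.mul (s : X → ℝ) (hs : PiecewiseConst s) (K : ℝ) (hK : 0 ≤ K) (hsK : ∀ᵐ x ∂ν, |s x| ≤ K) :
    PCM ν p →L[ℝ] PCM ν p :=
  LinearMap.mkContinuous
    { toFun := fun ω => PCM.mk (fun x => s x • ω.fn x) ((hs.prodMk ω.pc).comp fun b => b.1 • b.2) (by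
        refine (ω.memLp.const_mul K).of_le (measurable_pcmNorm
          ((hs.prodMk ω.pc).comp fun b => b.1 • b.2)).aestronglyMeasurable ?_
        filter_upwards [hsK, pcmNorm_mul hs ω.pc] with x h1 h2
        rw [h2, norm_mul, norm_mul, Real.norm_of_nonneg hK, Real.norm_eq_abs, abs_abs]
        exact mul_le_mul_of_nonneg_right h1 (norm_nonneg _))
      map_add' := fun ω ω' => PCM.ext (funext fun x => smul_add _ _ _)
      map_smul' := fun c ω => PCM.ext (funext fun x => smul_comm (s x) c (ω.fn x)) }
    K fun ω => PCM.norm_le_of_ae hK (by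
      filter_upwards [hsK, pcmNorm_mul hs ω.pc] with x h1 h2
      refine h2.trans_le (mul_le_mul_of_nonneg_right h1 (pcmNorm_nonneg _ x)))

/-- A piecewise constant function within `1 / (n + 1)` of `f`. -/
def step (f : X → ℝ) (n : ℕ) (x : X) : ℝ := ⌊((n : ℝ) + 1) * f x⌋ / ((n : ℝ) + 1)

lemma piecewiseConst_step {f : X → ℝ} (hf : Measurable f) (n : ℕ) : PiecewiseConst (step f n) := by
  have : PiecewiseConst fun x => ⌊((n : ℝ) + 1) * f x⌋ :=
    ⟨to_countable _, fun s => (hf.const_mul _).floor (MeasurableSet.of_discrete (s := s))⟩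
  exact this.comp fun k : ℤ => (k : ℝ) / ((n : ℝ) + 1)

lemma abs_step_sub_le (f : X → ℝ) (n : ℕ) (x : X) : |step f n x - f x| ≤ 1 / ((n : ℝ) + 1) := by
  have hn : (0 : ℝ) < (n : ℝ) + 1 := by positivity
  have h1 := Int.floor_le (((n : ℝ) + 1) * f x)
  have h2 := Int.lt_floor_add_one (((n : ℝ) + 1) * f x)
  have e : step f n x - f x = (⌊((n : ℝ) + 1) * f x⌋ - ((n : ℝ) + 1) * f x) / ((n : ℝ) + 1) := by
    rw [step]; field_simp
  rw [e, abs_div, abs_of_pos hn]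
  gcongr
  exact abs_le.2 ⟨by linarith, by linarith⟩

lemma abs_step_le (f : Lp ℝ ∞ ν) (n : ℕ) : ∀ᵐ x ∂ν, |step f n x| ≤ ‖f‖ + 1 := by
  have h : ∀ᵐ x ∂ν, ‖f x‖ ≤ ‖f‖ := by
    filter_upwards [ae_le_eLpNormEssSup (f := f) (μ := ν)] with x hx
    rw [← eLpNorm_exponent_top] at hx
    simpa [Lp.norm_def] using ENNReal.toReal_mono (Lp.eLpNorm_ne_top f) hx
  filter_upwards [h] with x hx
  have h1 := abs_step_sub_le f n x
  have h2 : 1 / ((n : ℝ) + 1) ≤ 1 := by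
    rw [div_le_one (by positivity)]; linarith [n.cast_nonneg (α := ℝ)]
  have h3 := abs_sub_abs_le_abs_sub (step f n x) (f x)
  rw [Real.norm_eq_abs] at hx
  linarith

/-- Multiplication by the `n`-th piecewise constant approximation of `f ∈ L^∞`. -/
def mulApprox (f : Lp ℝ ∞ ν) (n : ℕ) : Cotangent ν p →L[ℝ] Cotangent ν p :=
  (PCM.mul (step f n) (piecewiseConst_step (Lp.stronglyMeasurable f).measurable n) (‖f‖ + 1)
    (by positivity) (abs_step_le f n)).completion

lemma cauchySeq_mulApprox (f : Lp ℝ ∞ ν) : CauchySeq (mulApprox (p := p) f) := by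
  have hf := (Lp.stronglyMeasurable f).measurable
  refine cauchySeq_of_le_tendsto_0 (fun N : ℕ => 2 * (1 / ((N : ℝ) + 1))) ?_ ?_
  · intro n m N hn hm
    rw [dist_eq_norm]
    refine ContinuousLinearMap.opNorm_le_bound _ (by positivity) fun v => ?_
    induction v using UniformSpace.Completion.induction_on with
    | hp => exact isClosed_le (by fun_prop) (by fun_prop)
    | ih ω =>
      rw [sub_apply, mulApprox, mulApprox,
        ContinuousLinearMap.completion_apply_coe, ContinuousLinearMap.completion_apply_coe,
        ← UniformSpace.Completion.coe_sub, UniformSpace.Completion.norm_coe,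
        UniformSpace.Completion.norm_coe]
      refine PCM.norm_le_of_ae (by positivity) ?_
      have h := pcmNorm_mul (ν := ν) (p := p)
        (((piecewiseConst_step hf n).prodMk (piecewiseConst_step hf m)).comp
          fun b => b.1 - b.2) ω.pc
      filter_upwards [h] with x hx
      have e : (PCM.mul (step f n) (piecewiseConst_step hf n) (‖f‖ + 1) (by positivity)
          (abs_step_le f n) ω - PCM.mul (step f m) (piecewiseConst_step hf m) (‖f‖ + 1)
          (by positivity) (abs_step_le f m) ω).fn =
          fun x => (step f n x - step f m x) • ω.fn x := by
        funext x
        exact (sub_smul _ _ _).symm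
      rw [e, hx]
      refine mul_le_mul_of_nonneg_right ?_ (pcmNorm_nonneg _ x)
      have h1 := (abs_step_sub_le f n x).trans (one_div_le_one_div_of_le (by positivity)
        (add_le_add_left (Nat.cast_le.2 hn) (1 : ℝ)))
      have h2 := (abs_step_sub_le f m x).trans (one_div_le_one_div_of_le (by positivity)
        (add_le_add_left (Nat.cast_le.2 hm) (1 : ℝ)))
      rw [abs_sub_comm] at h2
      linarith [abs_sub_le (step f n x) (f x) (step f m x)]
  · simpa using tendsto_one_div_add_atTop_nhds_zero_nat.const_mul (2 : ℝ)

/-- The multiplication `f · v` of `v ∈ L^p(T^*X)` by `f ∈ L^∞(X, ν)`, the limit of the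
multiplications by piecewise constant functions converging uniformly to `f`. -/
def lmul (f : Lp ℝ ∞ ν) : Cotangent ν p →L[ℝ] Cotangent ν p :=
  limUnder atTop (mulApprox f)

lemma tendsto_mulApprox (f : Lp ℝ ∞ ν) : Tendsto (mulApprox (p := p) f) atTop (𝓝 (lmul f)) :=
  (cauchySeq_mulApprox f).tendsto_limUnder

/-- The differential `df = (f, X) ∈ L^p(T^*X)` of `f ∈ D^{1,p}(X)`. -/
def differential : D1p ν p →ₗ[ℝ] Cotangent ν p where
  toFun f := ((PCM.mk (fun _ => f) (.const f) (memLp_gradNorm f) : PCM ν p) : Cotangent ν p)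
  map_add' f g := by rw [← UniformSpace.Completion.coe_add]; rfl
  map_smul' c f := by rw [RingHom.id_apply, ← UniformSpace.Completion.coe_smul]; rfl

/-- The differential depends only on the `ν`-a.e. class. -/
lemma differential_congr {f g : D1p ν p} (h : (f : X → ℝ) =ᵐ[ν] (g : X → ℝ)) :
    differential f = differential g := by
  rw [← sub_eq_zero, ← map_sub]
  have h0 : gradNorm (f - g) =ᵐ[ν] 0 := by
    refine gradNorm_eq_zero_of_ae_eq_zero _ ?_
    filter_upwards [h] with x hx
    simp [hx]
  rw [← norm_eq_zero]
  change ‖((_ : PCM ν p) : Cotangent ν p)‖ = 0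
  rw [UniformSpace.Completion.norm_coe, PCM.norm_def]
  have : eLpNorm (pcmNorm fun _ : X => f - g) (ENNReal.ofReal p) ν = 0 := by
    rw [eLpNorm_congr_ae (f := pcmNorm fun _ : X => f - g) (g := 0) h0, eLpNorm_zero]
  exact (congrArg ENNReal.toReal this).trans ENNReal.toReal_zero

end Modules

/-! ### The functional, its subdifferential, and the operator -/

section Functional

variable {X : Type*} [MetricSpace X] [MeasurableSpace X] [BorelSpace X]
variable {ν : Measure X} {p : ℝ} [Fact (1 < p)]

/-- The class `u ∈ L^2(X, ν)` belongs to `W^{1,p}(X, d, ν) = D^{1,p}(X) ∩ L^p(X, ν)`, that is, it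
has a representative in `D^{1,p}(X)` and lies in `L^p`. -/
def IsSobolev (p : ℝ) [Fact (1 < p)] (u : Lp ℝ 2 ν) : Prop :=
  (∃ f : D1p ν p, (f : X → ℝ) =ᵐ[ν] u) ∧ MemLp u (ENNReal.ofReal p) ν

open Classical in
/-- The differential `du` of a class `u ∈ L^2(X, ν)` with a representative in `D^{1,p}(X)`; it does
not depend on the representative (and is `0` by convention if there is none). -/
def diff (p : ℝ) [Fact (1 < p)] (u : Lp ℝ 2 ν) : Cotangent ν p :=
  if h : ∃ f : D1p ν p, (f : X → ℝ) =ᵐ[ν] u then differential h.choose else 0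

lemma diff_eq {u : Lp ℝ 2 ν} {f : D1p ν p} (h : (f : X → ℝ) =ᵐ[ν] u) :
    diff p u = differential f := by
  have hex : ∃ f : D1p ν p, (f : X → ℝ) =ᵐ[ν] u := ⟨f, h⟩
  rw [diff, dif_pos hex]
  exact differential_congr (hex.choose_spec.trans h.symm)

/-- The `p'`-vector fields `L^{p'}(TX) = HOM(L^p(T^*X), L^1(X, ν))`: bounded linear maps that
commute with multiplication by functions in `L^∞`. The value `V v` is the pairing `v(V)`. -/
def VectorField (ν : Measure X) (p : ℝ) [Fact (1 < p)] :
    Submodule ℝ (Cotangent ν p →L[ℝ] Lp ℝ 1 ν) where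
  carrier := {V | ∀ (f : Lp ℝ ∞ ν) (v : Cotangent ν p), V (lmul f v) =ᵐ[ν] fun x => f x * V v x}
  zero_mem' := fun f v => by
    rw [zero_apply, zero_apply]
    filter_upwards [Lp.coeFn_zero ℝ 1 ν] with x hx
    rw [hx, Pi.zero_apply, mul_zero]
  add_mem' := by
    intro V W hV hW f v
    simp only [add_apply]
    filter_upwards [Lp.coeFn_add (V (lmul f v)) (W (lmul f v)), Lp.coeFn_add (V v) (W v), hV f v,
      hW f v] with x h1 h2 h3 h4
    rw [h1, h2, Pi.add_apply, Pi.add_apply, h3, h4, mul_add]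
  smul_mem' := by
    intro c V hV f v
    simp only [smul_apply]
    filter_upwards [Lp.coeFn_smul c (V (lmul f v)), Lp.coeFn_smul c (V v), hV f v] with x h1 h2 h3
    rw [h1, h2, Pi.smul_apply, Pi.smul_apply, h3, smul_eq_mul, smul_eq_mul, mul_left_comm]

/-- `V ∈ D^{p',2}(X)` with `div V = f`, for `f ∈ L^2(X, ν)`. -/
def HasDivergence (V : VectorField ν p) (f : Lp ℝ 2 ν) : Prop :=
  ∀ g : Lp ℝ 2 ν, IsSobolev p g →
    ∫ x, f x * g x ∂ν = - ∫ x, (V : Cotangent ν p →L[ℝ] Lp ℝ 1 ν) (diff p g) x ∂ν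

/-- The subdifferential `∂E(v)` in the duality between `L^p(T^*X)` and `L^{p'}(TX)` given by
`∫ v(V) dν`. -/
def cotangentSubdifferential (E : Cotangent ν p → ℝ) (v : Cotangent ν p) : Set (VectorField ν p) :=
  {V | ∀ w : Cotangent ν p,
    ∫ x, (V : Cotangent ν p →L[ℝ] Lp ℝ 1 ν) w x ∂ν ≤ E (v + w) - E v}

open Classical in
/-- The functional `F(u) = E(du)` if `u ∈ W^{1,p}(X, d, ν)` and `+∞` otherwise, on `L^2(X, ν)`. -/
def energy (E : Cotangent ν p → ℝ) (u : Lp ℝ 2 ν) : EReal :=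
  if IsSobolev p u then (E (diff p u) : EReal) else ⊤

/-- The (graph of the) subdifferential of a functional on a real Hilbert space. -/
def subdifferential {H : Type*} [NormedAddCommGroup H] [InnerProductSpace ℝ H] (F : H → EReal) :
    Set (H × H) :=
  {q | F q.1 < ⊤ ∧ ∀ w : H, F q.1 + ((inner ℝ w q.2 : ℝ) : EReal) ≤ F (q.1 + w)}

/-- The (graph of the) operator `A`: `(u, v) ∈ A` iff `u ∈ W^{1,p}` and `v = -div V` for some
`V ∈ D^{p',2}(X)` with `V ∈ ∂E(du)`. -/
def divergenceOperator (E : Cotangent ν p → ℝ) : Set (Lp ℝ 2 ν × Lp ℝ 2 ν) :=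
  {q | IsSobolev p q.1 ∧ ∃ V : VectorField ν p,
    HasDivergence V (-q.2) ∧ V ∈ cotangentSubdifferential E (diff p q.1)}

end Functional

end MetricSobolev

end

/-! Write `W` for the Sobolev functions in `L²`. The energy is `E ∘ d` on the subspace `W` and `+∞`
elsewhere, so the characterization is a chain rule for subdifferentials along the linear map `d`.
That a vector field in `∂E(du)` with divergence `-v` yields a subgradient `v` follows by testing its
subgradient inequality on differentials `dw`.

For the converse, let `v` be a subgradient at `u`, and put `N w = E (du + w) - E (du)`, which is
convex and continuous with `N 0 = 0`. The functional `w ↦ ⟨w, v⟩` on `W` lies below `N (dw)`, hence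
it vanishes where `dw = 0` and factors through a functional on the range of `d`. A Hahn-Banach
theorem with convex majorant, `exists_continuousLinear_extension_of_le_convex`, extends that
functional to a bounded one below `N` on the whole cotangent module. By
`exists_vectorField_integral_eq` it is the integral of the pairing with some vector field `V`; this
rests on the Radon-Nikodym theorem for the set functions `A ↦ L (χ_A ω)`. Domination by `N` says `V
∈ ∂E(du)`, and agreement with `⟨w, v⟩` on differentials says `div V = -v`.

Density of the domain combines two facts. Proximal points are points of subdifferentiability
approximating any point of finite energy (`subset_closure_setOf_exists_subgradient`); this uses that
the energy is convex, nonnegative and lower semicontinuous. And `W` itself is dense in `L²`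
(`dense_sobolevSubmodule`), because Lipschitz cut-offs of bounded closed sets belong to it and
already separate `L²` functions. -/

noncomputable section

set_option linter.unusedSectionVars false

namespace MetricSobolev

/-! ### Convex analysis: Hahn-Banach extension and proximal points. -/

section ConvexAnalysis

/-- Hahn-Banach theorem with a continuous convex majorant. -/
theorem exists_continuousLinear_extension_of_le_convex {V : Type*} [NormedAddCommGroup V]
    [NormedSpace ℝ V] {N : V → ℝ} (hN : ConvexOn ℝ univ N) (hc : Continuous N) (h0 : N 0 = 0)
    (f : V →ₗ.[ℝ] ℝ) (hf : ∀ x : f.domain, f x ≤ N x) :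
    ∃ g : V →L[ℝ] ℝ, (∀ x : f.domain, g x = f x) ∧ ∀ x, g x ≤ N x := by
  -- `q` is the one-sided directional derivative of `N` at `0`, the largest positively homogeneous
  -- function below `N`. A linear `f` below `N` is therefore below `q`, and the sublinear
  -- Hahn-Banach theorem applies to `q`.
  set q : V → ℝ := fun x => ⨅ t : Ioi (0 : ℝ), N (t.1 • x) / t.1 with hq
  have : Nonempty (Ioi (0 : ℝ)) := ⟨⟨1, mem_Ioi.2 one_pos⟩⟩
  have hbdd : ∀ x, BddBelow (range fun t : Ioi (0 : ℝ) => N (t.1 • x) / t.1) := by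
    intro x
    refine ⟨-N (-x), ?_⟩
    rintro _ ⟨⟨t, ht⟩, rfl⟩
    have ht : 0 < t := ht
    -- The weights make `0` a convex combination of `t • x` and `-x`, so `N 0 = 0` bounds the
    -- quotients below by `-N (-x)`, uniformly in `t`.
    have h := hN.2 (mem_univ (t • x)) (mem_univ (-x)) (by positivity : 0 ≤ 1 / (1 + t))
      (by positivity : 0 ≤ t / (1 + t)) (by field_simp)
    have e : (1 / (1 + t)) • t • x + (t / (1 + t)) • -x = 0 := by
      rw [smul_smul, smul_neg, ← sub_eq_add_neg, ← sub_smul]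
      have : 1 / (1 + t) * t - t / (1 + t) = 0 := by ring
      rw [this, zero_smul]
    rw [e, h0, smul_eq_mul, smul_eq_mul] at h
    have h' : 0 ≤ (N (t • x) + t * N (-x)) / (1 + t) := by
      refine h.trans (le_of_eq ?_); ring
    have h'' : 0 ≤ N (t • x) + t * N (-x) := by
      have := mul_nonneg h' (by positivity : 0 ≤ 1 + t)
      rwa [div_mul_cancel₀ _ (by positivity)] at this
    change -N (-x) ≤ N (t • x) / t
    rw [le_div_iff₀ ht]
    linarith
  have hle : ∀ x (t : ℝ), 0 < t → q x ≤ N (t • x) / t := fun x t ht => ciInf_le (hbdd x) ⟨t, ht⟩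
  have hhom : ∀ c : ℝ, 0 < c → ∀ x, q (c • x) ≤ c * q x := by
    intro c hc' x
    rw [mul_comm, ← div_le_iff₀ hc']
    refine le_ciInf fun ⟨t, ht⟩ => ?_
    have ht : 0 < t := ht
    rw [div_le_iff₀ hc']
    refine (hle _ (t / c) (div_pos ht hc')).trans (le_of_eq ?_)
    rw [smul_smul, div_mul_cancel₀ _ hc'.ne']
    field_simp
  have hqhom : ∀ c : ℝ, 0 < c → ∀ x, q (c • x) = c * q x := by
    intro c hc' x
    refine le_antisymm (hhom c hc' x) ?_
    have := hhom c⁻¹ (inv_pos.2 hc') (c • x)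
    rw [inv_smul_smul₀ hc'.ne'] at this
    rwa [← div_eq_inv_mul, le_div_iff₀ hc', mul_comm] at this
  have hqadd : ∀ x y, q (x + y) ≤ q x + q y := by
    intro x y
    refine le_ciInf_add_ciInf fun ⟨s, hs⟩ ⟨t, ht⟩ => ?_
    have hs : 0 < s := hs
    have ht : 0 < t := ht
    -- With this parameter, `(s * t / (s + t)) • (x + y)` is the convex combination of `s • x` and
    -- `t • y` with weights `t / (s + t)` and `s / (s + t)`.
    refine (hle _ (s * t / (s + t)) (by positivity)).trans ?_
    have h := hN.2 (mem_univ (s • x)) (mem_univ (t • y)) (by positivity : 0 ≤ t / (s + t))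
      (by positivity : 0 ≤ s / (s + t)) (by field_simp; ring)
    have e : (t / (s + t)) • s • x + (s / (s + t)) • t • y = (s * t / (s + t)) • (x + y) := by
      rw [smul_smul, smul_smul, smul_add]
      congr 2 <;> ring
    rw [e, smul_eq_mul, smul_eq_mul] at h
    rw [div_le_iff₀ (by positivity)]
    refine h.trans (le_of_eq ?_)
    field_simp
  have hqf : ∀ x : f.domain, f x ≤ q x := by
    intro x
    refine le_ciInf fun ⟨t, ht⟩ => ?_
    have ht : 0 < t := ht
    rw [le_div_iff₀ ht]
    have := hf (t • x)
    rw [f.map_smul, smul_eq_mul, mul_comm] at this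
    exact this
  obtain ⟨g, hg, hgq⟩ := exists_extension_of_le_sublinear f q hqhom hqadd hqf
  have hgN : ∀ x, g x ≤ N x := fun x => (hgq x).trans (by simpa using hle x 1 one_pos)
  -- The extension is so far only linear; it is continuous because it is squeezed between `-N (-x)`
  -- and `N x`, which both tend to `0` at the origin.
  refine ⟨⟨g, continuous_of_continuousAt_zero g ?_⟩, hg, hgN⟩
  have h1 : Tendsto N (𝓝 0) (𝓝 0) := by simpa [h0] using hc.tendsto 0
  have h2 : Tendsto (fun x => -N (-x)) (𝓝 0) (𝓝 0) := by
    have : Continuous fun x => -N (-x) := by fun_prop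
    simpa [h0] using this.tendsto 0
  rw [ContinuousAt, map_zero]
  refine tendsto_of_tendsto_of_tendsto_of_le_of_le h2 h1 (fun x => ?_) hgN
  have := hgN (-x)
  rw [map_neg] at this
  change -N (-x) ≤ g x
  linarith

variable {H : Type*} [NormedAddCommGroup H] [InnerProductSpace ℝ H] [CompleteSpace H]

/-- Existence of the proximal point of a nonnegative convex function with closed sublevel sets. -/
theorem exists_isMinOn_add_sq_norm_sub {S : Set H} {φ : H → ℝ} (hφ : ConvexOn ℝ S φ)
    (hpos : ∀ w ∈ S, 0 ≤ φ w) (hcl : ∀ a : ℝ, IsClosed {w | w ∈ S ∧ φ w ≤ a})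
    (hS : S.Nonempty) {c : ℝ} (hc : 0 < c) (u : H) :
    ∃ w ∈ S, IsMinOn (fun z => φ z + c * ‖z - u‖ ^ 2) S w := by
  set J : H → ℝ := fun z => φ z + c * ‖z - u‖ ^ 2 with hJ
  have hJpos : ∀ z ∈ S, 0 ≤ J z := fun z hz => add_nonneg (hpos z hz) (by positivity)
  have hbdd : BddBelow (J '' S) := ⟨0, by rintro _ ⟨z, hz, rfl⟩; exact hJpos z hz⟩
  set m := sInf (J '' S) with hm
  have hmle : ∀ z ∈ S, m ≤ J z := fun z hz => csInf_le hbdd ⟨z, hz, rfl⟩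
  have hex : ∀ n : ℕ, ∃ z ∈ S, J z < m + 1 / ((n : ℝ) + 1) := by
    intro n
    obtain ⟨_, ⟨z, hz, rfl⟩, h⟩ := exists_lt_of_csInf_lt (hS.image J)
      (lt_add_of_pos_right m (by positivity : 0 < 1 / ((n : ℝ) + 1)))
    exact ⟨z, hz, h⟩
  choose z hzS hz using hex
  -- Uniform convexity of `J`: test the infimum at the midpoint and use the parallelogram law. It
  -- forces minimizing sequences to be Cauchy.
  have key : ∀ x ∈ S, ∀ y ∈ S, m + c / 4 * ‖x - y‖ ^ 2 ≤ (J x + J y) / 2 := by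
    intro x hx y hy
    have half : (0 : ℝ) ≤ 1 / 2 := by norm_num
    have hmid := hφ.1 hx hy half half (by norm_num)
    have h1 := hφ.2 hx hy half half (by norm_num)
    have h2 := hmle _ hmid
    have h3 := parallelogram_law_with_norm ℝ (x - u) (y - u)
    have e1 : x - u + (y - u) = (2 : ℝ) • ((1 / 2 : ℝ) • x + (1 / 2 : ℝ) • y - u) := by
      module
    have e2 : x - u - (y - u) = x - y := by abel
    rw [e1, e2, norm_smul, Real.norm_eq_abs, abs_two] at h3
    simp only [hJ, smul_eq_mul] at h1 h2 ⊢
    set n0 := ‖(1 / 2 : ℝ) • x + (1 / 2 : ℝ) • y - u‖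
    nlinarith [congrArg (fun r => c * r) h3]
  have hcau : CauchySeq z := by
    refine cauchySeq_of_le_tendsto_0 (fun N : ℕ => √(4 / c * (1 / ((N : ℝ) + 1)))) ?_ ?_
    · intro n k N hn hk
      rw [dist_eq_norm]
      refine Real.le_sqrt_of_sq_le ?_
      have h1 := key _ (hzS n) _ (hzS k)
      have hn' : 1 / ((n : ℝ) + 1) ≤ 1 / ((N : ℝ) + 1) :=
        one_div_le_one_div_of_le (by positivity) (by gcongr)
      have hk' : 1 / ((k : ℝ) + 1) ≤ 1 / ((N : ℝ) + 1) :=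
        one_div_le_one_div_of_le (by positivity) (by gcongr)
      have h2 : c / 4 * ‖z n - z k‖ ^ 2 ≤ 1 / ((N : ℝ) + 1) := by
        linarith [(hz n).le, (hz k).le]
      calc ‖z n - z k‖ ^ 2 = 4 / c * (c / 4 * ‖z n - z k‖ ^ 2) := by field_simp
        _ ≤ _ := mul_le_mul_of_nonneg_left h2 (by positivity)
    · have := (tendsto_one_div_add_atTop_nhds_zero_nat (𝕜 := ℝ)).const_mul (4 / c)
      simpa [Function.comp_def] using (Real.continuous_sqrt.tendsto _).comp this
  obtain ⟨w, hw⟩ := cauchySeq_tendsto_of_complete hcau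
  have hlim : Tendsto (fun n : ℕ => m + 1 / ((n : ℝ) + 1) - c * ‖z n - u‖ ^ 2) atTop
      (𝓝 (m + 0 - c * ‖w - u‖ ^ 2)) :=
    (tendsto_const_nhds.add tendsto_one_div_add_atTop_nhds_zero_nat).sub
      (((hw.sub_const u).norm.pow 2).const_mul c)
  -- `S` need not be closed: that the limit lies in `S` comes from the closed sublevel sets, since
  -- `φ (z n)` is eventually below this level.
  have hmem : ∀ ε > 0, w ∈ S ∧ φ w ≤ m - c * ‖w - u‖ ^ 2 + ε := by
    intro ε hε
    refine (hcl (m - c * ‖w - u‖ ^ 2 + ε)).mem_of_tendsto hw ?_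
    filter_upwards [hlim.eventually (Iio_mem_nhds
      (show m + 0 - c * ‖w - u‖ ^ 2 < m - c * ‖w - u‖ ^ 2 + ε by linarith))]
      with n hn
    refine ⟨hzS n, ?_⟩
    have := hz n
    simp only [hJ] at this
    have hn : m + 1 / ((n : ℝ) + 1) - c * ‖z n - u‖ ^ 2 < _ := hn
    linarith
  refine ⟨w, (hmem 1 one_pos).1, fun y hy => ?_⟩
  have h1 : φ w ≤ m - c * ‖w - u‖ ^ 2 := le_of_forall_pos_le_add fun ε hε => (hmem ε hε).2
  have h2 := hmle y hy
  change φ w + c * ‖w - u‖ ^ 2 ≤ J y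
  linarith

/-- The optimality condition for the proximal point. -/
theorem inner_add_le_of_isMinOn_add_sq_norm_sub {S : Set H} {φ : H → ℝ} (hφ : ConvexOn ℝ S φ)
    {c : ℝ} {u w : H} (hw : w ∈ S)
    (hmin : IsMinOn (fun z => φ z + c * ‖z - u‖ ^ 2) S w) {y : H} (hy : y ∈ S) :
    φ w + inner ℝ (y - w) ((2 * c) • (u - w)) ≤ φ y := by
  have hstep : ∀ t : ℝ, 0 < t → t ≤ 1 →
      φ w + inner ℝ (y - w) ((2 * c) • (u - w)) ≤ φ y + t * (c * ‖y - w‖ ^ 2) := by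
    intro t ht ht1
    -- Compare `w` with a point of the segment towards `y`. The quadratic remainder is of order `t ^
    -- 2`, so it disappears after division by `t` and the limit `t → 0`.
    have hS := hφ.1 hw hy (sub_nonneg.2 ht1) ht.le (by ring)
    have h1 := hφ.2 hw hy (sub_nonneg.2 ht1) ht.le (by ring)
    have h2 : φ w + c * ‖w - u‖ ^ 2 ≤ φ ((1 - t) • w + t • y) + c * ‖(1 - t) • w + t • y - u‖ ^ 2 :=
      hmin hS
    have e : (1 - t) • w + t • y - u = (w - u) + t • (y - w) := by module
    rw [e, norm_add_sq_real, norm_smul, Real.norm_eq_abs, abs_of_pos ht, inner_smul_right] at h2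
    have e' : inner ℝ (y - w) ((2 * c) • (u - w)) = -(2 * c) * inner ℝ (w - u) (y - w) := by
      rw [inner_smul_right, ← neg_sub w u, inner_neg_right, real_inner_comm]; ring
    rw [e']
    simp only [smul_eq_mul] at h1
    have h3 : t * (φ w + -(2 * c) * inner ℝ (w - u) (y - w)) ≤
        t * (φ y + t * (c * ‖y - w‖ ^ 2)) := by linarith
    exact le_of_mul_le_mul_left h3 ht
  have hlim : Tendsto (fun t : ℝ => φ y + t * (c * ‖y - w‖ ^ 2)) (𝓝[>] 0) (𝓝 (φ y)) := by
    have : Continuous fun t : ℝ => φ y + t * (c * ‖y - w‖ ^ 2) := by fun_prop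
    simpa using (this.tendsto 0).mono_left nhdsWithin_le_nhds
  refine ge_of_tendsto hlim ?_
  filter_upwards [Ioc_mem_nhdsGT (zero_lt_one (α := ℝ))] with t ht
  exact hstep t ht.1 ht.2

/-- The points at which a nonnegative convex function with closed sublevel sets has a subgradient
are dense in its domain. -/
theorem subset_closure_setOf_exists_subgradient {S : Set H} {φ : H → ℝ} (hφ : ConvexOn ℝ S φ)
    (hpos : ∀ w ∈ S, 0 ≤ φ w) (hcl : ∀ a : ℝ, IsClosed {w | w ∈ S ∧ φ w ≤ a}) :
    S ⊆ closure {w | w ∈ S ∧ ∃ v : H, ∀ y ∈ S, φ w + inner ℝ (y - w) v ≤ φ y} := by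
  intro u hu
  rw [Metric.mem_closure_iff]
  intro ε hε
  -- Minimality gives `c * ‖w - u‖ ^ 2 ≤ φ u`, and this choice makes `c * ε ^ 2 = φ u + 1` strictly
  -- larger.
  set c := (φ u + 1) / ε ^ 2 with hc'
  have hu0 := hpos u hu
  have hc : 0 < c := by positivity
  obtain ⟨w, hw, hmin⟩ := exists_isMinOn_add_sq_norm_sub hφ hpos hcl ⟨u, hu⟩ hc u
  refine ⟨w, ⟨hw, (2 * c) • (u - w), fun y hy =>
    inner_add_le_of_isMinOn_add_sq_norm_sub hφ hw hmin hy⟩, ?_⟩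
  have h1 : φ w + c * ‖w - u‖ ^ 2 ≤ φ u + c * ‖u - u‖ ^ 2 := hmin hu
  rw [sub_self, norm_zero] at h1
  have h2 := hpos w hw
  have h3 : c * ‖w - u‖ ^ 2 < c * ε ^ 2 := by
    have : c * ε ^ 2 = φ u + 1 := by rw [hc']; field_simp
    rw [this]; linarith
  rw [dist_comm, dist_eq_norm]
  exact lt_of_pow_lt_pow_left₀ 2 hε.le (lt_of_mul_lt_mul_left h3 hc.le)

end ConvexAnalysis

/-! ### Representation of bounded functionals on the cotangent module by vector fields. -/

section Representation

variable {X : Type*} [MetricSpace X] [MeasurableSpace X] [BorelSpace X]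
variable {ν : Measure X} {p : ℝ} [hp : Fact (1 < p)]

lemma piecewiseConst_indicator_one {A : Set X} (hA : MeasurableSet A) :
    PiecewiseConst (A.indicator fun _ => (1 : ℝ)) := by
  refine ⟨((countable_singleton (0 : ℝ)).insert 1).mono ?_, fun s => ?_⟩
  · rintro _ ⟨x, rfl⟩
    by_cases hx : x ∈ A <;> simp [hx]
  · rcases indicator_const_preimage A s (1 : ℝ) with h | h | h | h
    · rw [h]; exact .univ
    · rw [h]; exact hA
    · rw [h]; exact hA.compl
    · rw [mem_singleton_iff.1 h]; exact .empty

lemma PCM.fn_mul {s : X → ℝ} (hs : PiecewiseConst s) {K : ℝ} (hK : 0 ≤ K)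
    (hsK : ∀ᵐ x ∂ν, |s x| ≤ K) (ω : PCM ν p) :
    (PCM.mul s hs K hK hsK ω).fn = fun x => s x • ω.fn x := rfl

/-- Multiplication of elements of `PCM_p` by the indicator function of a Borel set. -/
def PCM.cut (A : Set X) (hA : MeasurableSet A) : PCM ν p →L[ℝ] PCM ν p :=
  PCM.mul (A.indicator fun _ => (1 : ℝ)) (piecewiseConst_indicator_one hA) 1 zero_le_one
    (.of_forall fun x => by by_cases hx : x ∈ A <;> simp [hx])

lemma PCM.fn_cut {A : Set X} (hA : MeasurableSet A) (ω : PCM ν p) :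
    (PCM.cut A hA ω).fn = fun x => A.indicator (fun _ => (1 : ℝ)) x • ω.fn x := rfl

lemma PCM.norm_cut {A : Set X} (hA : MeasurableSet A) (ω : PCM ν p) :
    ‖PCM.cut A hA ω‖ =
      (eLpNorm (pcmNorm ω.fn) (ENNReal.ofReal p) (ν.restrict A)).toReal := by
  rw [PCM.norm_def, PCM.fn_cut, ← eLpNorm_indicator_eq_eLpNorm_restrict hA]
  congr 1
  refine eLpNorm_congr_ae ?_
  filter_upwards [pcmNorm_mul (piecewiseConst_indicator_one hA) ω.pc] with x hx
  rw [hx]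
  by_cases hxA : x ∈ A <;> simp [hxA]

lemma PCM.norm_cut_le {A : Set X} (hA : MeasurableSet A) (ω : PCM ν p) :
    ‖PCM.cut A hA ω‖ ≤ ‖ω‖ := by
  rw [PCM.norm_cut, PCM.norm_def]
  exact ENNReal.toReal_mono ω.memLp.2.ne (eLpNorm_mono_measure _ Measure.restrict_le_self)

lemma PCM.cut_sub_cut {A B : Set X} (hA : MeasurableSet A) (hB : MeasurableSet B) (h : A ⊆ B)
    (ω : PCM ν p) :
    PCM.cut B hB ω - PCM.cut A hA ω = PCM.cut (B \ A) (hB.diff hA) ω := by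
  refine PCM.ext (funext fun x => ?_)
  rw [PCM.fn_sub, Pi.sub_apply, PCM.fn_cut, PCM.fn_cut, PCM.fn_cut]
  by_cases hxA : x ∈ A
  · simp [hxA, h hxA]
  · by_cases hxB : x ∈ B <;> simp [hxA, hxB]

lemma PCM.cut_cut {A B : Set X} (hA : MeasurableSet A) (hB : MeasurableSet B) (ω : PCM ν p) :
    PCM.cut A hA (PCM.cut B hB ω) = PCM.cut (A ∩ B) (hA.inter hB) ω := by
  refine PCM.ext (funext fun x => ?_)
  rw [PCM.fn_cut, PCM.fn_cut, PCM.fn_cut]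
  by_cases hxA : x ∈ A <;> by_cases hxB : x ∈ B <;> simp [hxA, hxB]

lemma PCM.cut_univ (ω : PCM ν p) : PCM.cut univ .univ ω = ω := by
  refine PCM.ext (funext fun x => ?_)
  simp [PCM.fn_cut]

/-- On a level set of `s` multiplication by `s` is a real scalar multiplication; hence mere
`ℝ`-linearity will control multiplication by piecewise constant functions. -/
lemma PCM.cut_mul {s : X → ℝ} (hs : PiecewiseConst s) {K : ℝ} (hK : 0 ≤ K)
    (hsK : ∀ᵐ x ∂ν, |s x| ≤ K) (c : ℝ) (ω : PCM ν p) :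
    PCM.cut (s ⁻¹' {c}) (hs.2 _) (PCM.mul s hs K hK hsK ω) =
      c • PCM.cut (s ⁻¹' {c}) (hs.2 _) ω := by
  refine PCM.ext (funext fun x => ?_)
  rw [PCM.fn_cut, PCM.fn_mul, PCM.fn_smul, Pi.smul_apply, PCM.fn_cut]
  by_cases hx : s x = c <;> simp [hx]

/-- Continuity from above of a finite measure. The index set is general because unconditional
summation needs it for the finite subsets of `ℕ`. -/
lemma PCM.tendsto_norm_cut {ι : Type*} [Preorder ι] [(atTop : Filter ι).IsCountablyGenerated]
    [Nonempty ι] {B : ι → Set X} (hB : ∀ i, MeasurableSet (B i)) (hanti : Antitone B)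
    (hempty : ⋂ i, B i = ∅) (ω : PCM ν p) :
    Tendsto (fun i => ‖PCM.cut (B i) (hB i) ω‖) atTop (𝓝 0) := by
  have h0 : 0 < p := zero_lt_one.trans hp.out
  have hne : ENNReal.ofReal p ≠ 0 := by simpa using h0
  -- The finite measure `|ω|^p ν`; the norm of `PCM.cut A hA ω` is `μ A ^ (1 / p)`.
  set μ : Measure X := ν.withDensity fun x => ‖pcmNorm ω.fn x‖ₑ ^ p with hμ
  have hfin : μ univ ≠ ∞ := by
    rw [hμ, withDensity_apply _ .univ, Measure.restrict_univ]
    have := ω.memLp.2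
    rw [eLpNorm_lt_top_iff_lintegral_rpow_enorm_lt_top hne ENNReal.ofReal_ne_top,
      ENNReal.toReal_ofReal h0.le] at this
    exact this.ne
  have hlim : Tendsto (μ ∘ B) atTop (𝓝 0) := by
    have := tendsto_measure_iInter_atTop (μ := μ) (fun i => (hB i).nullMeasurableSet) hanti
      ⟨Classical.arbitrary ι, ne_top_of_le_ne_top hfin (measure_mono (subset_univ _))⟩
    simpa [hempty] using this
  have h1 : Tendsto (fun i => (μ (B i)) ^ (1 / p)) atTop (𝓝 0) := by
    have := (ENNReal.continuous_rpow_const (y := 1 / p)).tendsto 0 |>.comp hlim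
    rwa [ENNReal.zero_rpow_of_pos (by positivity)] at this
  have h2 := (ENNReal.tendsto_toReal ENNReal.zero_ne_top).comp h1
  rw [ENNReal.toReal_zero] at h2
  refine h2.congr fun i => ?_
  rw [PCM.norm_cut, eLpNorm_eq_lintegral_rpow_enorm_toReal hne ENNReal.ofReal_ne_top,
    ENNReal.toReal_ofReal h0.le, Function.comp_apply, hμ, withDensity_apply _ (hB i)]

/-- The remainder after a finite partial sum is the cut of `ω` to the sets not yet used, and these
decrease to `∅`. This is the σ-additivity of `pairingMeasure`. -/
lemma PCM.hasSum_cut {A : ℕ → Set X} (hA : ∀ i, MeasurableSet (A i))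
    (hd : Pairwise (Function.onFun Disjoint A)) (ω : PCM ν p) :
    HasSum (fun i => PCM.cut (A i) (hA i) ω) (PCM.cut (⋃ i, A i) (.iUnion hA) ω) := by
  have hB : ∀ F : Finset ℕ, MeasurableSet ((⋃ i, A i) \ ⋃ i ∈ F, A i) := fun F =>
    (MeasurableSet.iUnion hA).diff (F.measurableSet_biUnion fun i _ => hA i)
  have hrem : ∀ F : Finset ℕ, PCM.cut (⋃ i, A i) (.iUnion hA) ω -
      ∑ i ∈ F, PCM.cut (A i) (hA i) ω = PCM.cut _ (hB F) ω := by
    intro F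
    induction F using Finset.induction_on with
    | empty => simp
    | insert a F ha ih =>
      rw [Finset.sum_insert ha, add_comm, ← sub_sub, ih, PCM.cut_sub_cut (hA a) (hB F)]
      · have e : ((⋃ i, A i) \ ⋃ i ∈ F, A i) \ A a = (⋃ i, A i) \ ⋃ i ∈ insert a F, A i := by
          ext x
          simp only [Set.mem_sdiff, Finset.mem_insert, iUnion_iUnion_eq_or_left, mem_union]
          tauto
        simp only [e]
      · intro x hx
        refine ⟨mem_iUnion.2 ⟨a, hx⟩, fun h => ?_⟩
        obtain ⟨i, hi, hxi⟩ := mem_iUnion₂.1 h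
        exact disjoint_left.1 (hd (ne_of_mem_of_not_mem hi ha).symm) hx hxi
  refine tendsto_iff_norm_sub_tendsto_zero.2 ?_
  have := PCM.tendsto_norm_cut hB (fun F G hFG => sdiff_subset_sdiff_right
    (biUnion_subset_biUnion_left hFG)) (by
      refine eq_empty_of_forall_notMem fun x hx => ?_
      rw [mem_iInter] at hx
      obtain ⟨i, hi⟩ := mem_iUnion.1 (hx ∅).1
      exact (hx {i}).2 (by simpa using hi)) ω
  refine this.congr fun F => ?_
  rw [← hrem F, norm_sub_rev]

open Classical in
/-- The signed measure `A ↦ L(χ_A ω)`. -/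
def pairingMeasure (L : PCM ν p →L[ℝ] ℝ) (ω : PCM ν p) : SignedMeasure X where
  measureOf' A := if hA : MeasurableSet A then L (PCM.cut A hA ω) else 0
  empty' := by
    have : PCM.cut ∅ .empty ω = 0 := PCM.ext (funext fun x => by simp [PCM.fn_cut]; rfl)
    rw [dif_pos .empty, this, map_zero]
  not_measurable' A hA := dif_neg hA
  m_iUnion' A hA hd := by
    simp only [dif_pos (hA _), dif_pos (MeasurableSet.iUnion hA)]
    exact (PCM.hasSum_cut hA hd ω).mapL L

lemma pairingMeasure_apply (L : PCM ν p →L[ℝ] ℝ) (ω : PCM ν p) {A : Set X}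
    (hA : MeasurableSet A) : pairingMeasure L ω A = L (PCM.cut A hA ω) :=
  dif_pos hA

/-- A bounded functional on `PCM_p` has, in the direction `ω`, a density with respect to `ν`. -/
lemma exists_pairing_density [SigmaFinite ν] (L : PCM ν p →L[ℝ] ℝ) (ω : PCM ν p) :
    ∃ h : Lp ℝ 1 ν, ∀ (A : Set X) (hA : MeasurableSet A), ∫ x in A, h x ∂ν = L (PCM.cut A hA ω) := by
  have hac : pairingMeasure L ω ≪ᵥ ν.toENNRealVectorMeasure := by
    refine .mk fun A hA h0 => ?_
    rw [Measure.toENNRealVectorMeasure_apply_measurable hA] at h0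
    -- `PCM ν p` is only seminormed, so a cut to a null set has norm zero without having to be zero;
    -- boundedness of `L` then makes its value vanish.
    have hn : ‖PCM.cut A hA ω‖ = 0 := by
      rw [PCM.norm_cut, Measure.restrict_eq_zero.2 h0, eLpNorm_measure_zero, ENNReal.toReal_zero]
    rw [pairingMeasure_apply L ω hA, ← norm_eq_zero]
    refine le_antisymm ((L.le_opNorm _).trans ?_) (norm_nonneg _)
    rw [hn, mul_zero]
  have hd := (SignedMeasure.absolutelyContinuous_iff_withDensityᵥ_rnDeriv_eq _ ν).1 hac
  have hint := SignedMeasure.integrable_rnDeriv (pairingMeasure L ω) ν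
  refine ⟨hint.toL1 _, fun A hA => ?_⟩
  rw [← pairingMeasure_apply L ω hA]
  refine Eq.trans ?_ ((withDensityᵥ_apply hint hA).symm.trans (congrArg (fun μ => μ A) hd))
  exact setIntegral_congr_ae hA (hint.coeFn_toL1.mono fun x hx _ => hx)

lemma L1_ext_of_setIntegral_eq {f g : Lp ℝ 1 ν}
    (h : ∀ A, MeasurableSet A → ∫ x in A, f x ∂ν = ∫ x in A, g x ∂ν) : f = g :=
  Lp.ext (Integrable.ae_eq_of_forall_setIntegral_eq _ _ (L1.integrable_coeFn f)
    (L1.integrable_coeFn g) fun A hA _ => h A hA)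

/-- The densities of a bounded functional on `PCM_p` depend linearly and boundedly on the
direction. -/
lemma exists_pairing_clm [SigmaFinite ν] (L : PCM ν p →L[ℝ] ℝ) :
    ∃ V : PCM ν p →L[ℝ] Lp ℝ 1 ν, ∀ (ω : PCM ν p) (A : Set X) (hA : MeasurableSet A),
      ∫ x in A, V ω x ∂ν = L (PCM.cut A hA ω) := by
  choose W hW using exists_pairing_density L
  refine ⟨LinearMap.mkContinuous
    { toFun := W
      map_add' := fun ω ω' => L1_ext_of_setIntegral_eq fun A hA => ?_
      map_smul' := fun c ω => L1_ext_of_setIntegral_eq fun A hA => ?_ } (2 * ‖L‖) fun ω => ?_, hW⟩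
  · rw [hW _ _ hA, map_add, map_add, ← hW ω, ← hW ω', ← integral_add
      (L1.integrable_coeFn _).integrableOn (L1.integrable_coeFn _).integrableOn]
    refine setIntegral_congr_ae hA ((Lp.coeFn_add (W ω) (W ω')).mono fun x hx _ => ?_)
    rw [hx, Pi.add_apply]
  · rw [hW _ _ hA, map_smul, map_smul, ← hW ω, smul_eq_mul, ← integral_const_mul]
    refine setIntegral_congr_ae hA ((Lp.coeFn_smul c (W ω)).mono fun x hx _ => ?_)
    rw [RingHom.id_apply, hx, Pi.smul_apply, smul_eq_mul]
  · change ‖W ω‖ ≤ _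
    have hm := (Lp.stronglyMeasurable (W ω)).measurable
    have hle : ∀ (A : Set X) (hA : MeasurableSet A), |L (PCM.cut A hA ω)| ≤ ‖L‖ * ‖ω‖ :=
      fun A hA => (L.le_opNorm _).trans
        (mul_le_mul_of_nonneg_left (PCM.norm_cut_le hA ω) (norm_nonneg _))
    -- The `L¹` norm of the density is a difference of two values of `L` on cuts of `ω`, over `{0 ≤
    -- W ω}` and `{W ω ≤ 0}`, each at most `‖L‖ * ‖ω‖` in absolute value; whence the factor `2`.
    rw [L1.norm_eq_integral_norm, integral_norm_eq_pos_sub_neg (L1.integrable_coeFn _),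
      hW ω _ (measurableSet_le measurable_const hm), hW ω _ (measurableSet_le hm measurable_const)]
    linarith [abs_le.1 (hle _ (measurableSet_le (f := fun _ => (0 : ℝ)) measurable_const hm)),
      abs_le.1 (hle _ (measurableSet_le (g := fun _ => (0 : ℝ)) hm measurable_const))]

/-- Multiplication of elements of the cotangent module by the indicator function of a Borel set. -/
def Cotangent.cut (A : Set X) (hA : MeasurableSet A) : Cotangent ν p →L[ℝ] Cotangent ν p :=
  (PCM.cut A hA).completion

lemma Cotangent.cut_coe {A : Set X} (hA : MeasurableSet A) (ω : PCM ν p) :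
    Cotangent.cut A hA (ω : Cotangent ν p) = (PCM.cut A hA ω : PCM ν p) :=
  ContinuousLinearMap.completion_apply_coe _ _

lemma Cotangent.cut_cut {A B : Set X} (hA : MeasurableSet A) (hB : MeasurableSet B)
    (v : Cotangent ν p) :
    Cotangent.cut A hA (Cotangent.cut B hB v) = Cotangent.cut (A ∩ B) (hA.inter hB) v := by
  induction v using UniformSpace.Completion.induction_on with
  | hp => exact isClosed_eq (by fun_prop) (by fun_prop)
  | ih ω => rw [cut_coe, cut_coe, cut_coe, PCM.cut_cut]

lemma Cotangent.cut_univ (v : Cotangent ν p) : Cotangent.cut univ .univ v = v := by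
  induction v using UniformSpace.Completion.induction_on with
  | hp => exact isClosed_eq (by fun_prop) (by fun_prop)
  | ih ω => rw [cut_coe, PCM.cut_univ]

lemma Cotangent.cut_mul {s : X → ℝ} (hs : PiecewiseConst s) {K : ℝ} (hK : 0 ≤ K)
    (hsK : ∀ᵐ x ∂ν, |s x| ≤ K) (c : ℝ) (v : Cotangent ν p) :
    Cotangent.cut (s ⁻¹' {c}) (hs.2 _) ((PCM.mul s hs K hK hsK).completion v) =
      c • Cotangent.cut (s ⁻¹' {c}) (hs.2 _) v := by
  induction v using UniformSpace.Completion.induction_on with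
  | hp =>
    exact isClosed_eq ((Cotangent.cut _ _).continuous.comp (ContinuousLinearMap.continuous _))
      ((Cotangent.cut _ _).continuous.const_smul c)
  | ih ω =>
    rw [ContinuousLinearMap.completion_apply_coe, cut_coe, cut_coe, PCM.cut_mul,
      UniformSpace.Completion.coe_smul]

section Density

variable {L : Cotangent ν p →L[ℝ] ℝ} {V : Cotangent ν p →L[ℝ] Lp ℝ 1 ν}

/-- Both sides have the same integral over every Borel set, since successive cuts amount to a cut to
the intersection. It is the locality from which `L^∞`-linearity is derived. -/
lemma map_cut_ae_eq
    (hV : ∀ v (A : Set X) (hA : MeasurableSet A), ∫ x in A, V v x ∂ν = L (Cotangent.cut A hA v))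
    {B : Set X} (hB : MeasurableSet B) (v : Cotangent ν p) :
    V (Cotangent.cut B hB v) =ᵐ[ν] B.indicator (V v) := by
  refine Integrable.ae_eq_of_forall_setIntegral_eq _ _ (L1.integrable_coeFn _)
    ((L1.integrable_coeFn _).indicator hB) fun A hA _ => ?_
  rw [hV _ _ hA, Cotangent.cut_cut, setIntegral_indicator hB, hV _ _ (hA.inter hB)]

lemma map_mul_ae_eq
    (hV : ∀ v (A : Set X) (hA : MeasurableSet A), ∫ x in A, V v x ∂ν = L (Cotangent.cut A hA v))
    {s : X → ℝ} (hs : PiecewiseConst s) {K : ℝ} (hK : 0 ≤ K) (hsK : ∀ᵐ x ∂ν, |s x| ≤ K)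
    (v : Cotangent ν p) :
    V ((PCM.mul s hs K hK hsK).completion v) =ᵐ[ν] fun x => s x * V v x := by
  set w := (PCM.mul s hs K hK hsK).completion v with hw
  -- As `s` takes countably many values, it suffices to prove the identity almost everywhere on each
  -- level set.
  refine hs.ae (P := fun c x => s x = c → V w x = c * V v x) (fun c => ?_) |>.mono
    fun x hx => hx rfl
  have h1 := map_cut_ae_eq hV (hs.2 {c}) w
  have h2 := map_cut_ae_eq hV (hs.2 {c}) v
  rw [hw, Cotangent.cut_mul, map_smul, ← hw] at h1
  filter_upwards [h1, h2, Lp.coeFn_smul c (V (Cotangent.cut (s ⁻¹' {c}) (hs.2 _) v))]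
    with x h1 h2 h3 hx
  have hmem : x ∈ s ⁻¹' {c} := hx
  rw [h3, Pi.smul_apply, h2, indicator_of_mem hmem, indicator_of_mem hmem] at h1
  exact h1.symm

lemma map_lmul_ae_eq
    (hV : ∀ v (A : Set X) (hA : MeasurableSet A), ∫ x in A, V v x ∂ν = L (Cotangent.cut A hA v))
    (f : Lp ℝ ∞ ν) (v : Cotangent ν p) : V (lmul f v) =ᵐ[ν] fun x => f x * V v x := by
  have hlim : Tendsto (fun n => V (mulApprox f n v)) atTop (𝓝 (V (lmul f v))) :=
    (V.continuous.tendsto _).comp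
      (((ContinuousLinearMap.apply ℝ (Cotangent ν p) v).continuous.tendsto _).comp
        (tendsto_mulApprox f))
  -- The step functions converge to `f` everywhere, but their images under `V` converge only in
  -- `L¹`, so the limits are compared along an almost everywhere convergent subsequence.
  obtain ⟨k, hk, hae⟩ := (tendstoInMeasure_of_tendsto_Lp hlim).exists_seq_tendsto_ae
  have hn : ∀ᵐ x ∂ν, ∀ n, V (mulApprox f n v) x = step f n x * V v x :=
    ae_all_iff.2 fun n => map_mul_ae_eq hV _ _ _ v
  filter_upwards [hae, hn] with x hx hn
  refine tendsto_nhds_unique hx ?_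
  simp only [hn]
  refine Tendsto.mul_const _ (Tendsto.comp (g := fun n => step f n x) ?_ hk.tendsto_atTop)
  exact tendsto_iff_norm_sub_tendsto_zero.2 (squeeze_zero (fun n => norm_nonneg _)
    (fun n => abs_step_sub_le f n x) tendsto_one_div_add_atTop_nhds_zero_nat)

end Density

/-- Every bounded functional on the cotangent module is the integral of the pairing with a vector
field. -/
theorem exists_vectorField_integral_eq [SigmaFinite ν] (L : Cotangent ν p →L[ℝ] ℝ) :
    ∃ V : VectorField ν p, ∀ w : Cotangent ν p,
      ∫ x, (V : Cotangent ν p →L[ℝ] Lp ℝ 1 ν) w x ∂ν = L w := by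
  obtain ⟨V, hV⟩ := exists_pairing_clm (L.comp UniformSpace.Completion.toComplL)
  have hV' : ∀ v (A : Set X) (hA : MeasurableSet A),
      ∫ x in A, V.fromCompletion v x ∂ν = L (Cotangent.cut A hA v) := by
    intro v A hA
    induction v using UniformSpace.Completion.induction_on with
    | hp =>
      exact isClosed_eq ((continuous_setIntegral A).comp V.fromCompletion.continuous)
        (by fun_prop)
    | ih ω =>
      rw [ContinuousLinearMap.fromCompletion_apply_coe, hV ω A hA, Cotangent.cut_coe]
      rfl
  refine ⟨⟨V.fromCompletion, map_lmul_ae_eq hV'⟩, fun w => ?_⟩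
  have := hV' w univ .univ
  rwa [Measure.restrict_univ, Cotangent.cut_univ] at this

end Representation

/-! ### Upper gradients of Lipschitz functions. -/

section Lipschitz

variable {X : Type*} [MetricSpace X]

lemma Curve.dist_le (γ : Curve X) {s t : ℝ} (hs : γ.a ≤ s) (hst : s ≤ t) (ht : t ≤ γ.b) :
    dist (γ.toFun s) (γ.toFun t) ≤ t - s := by
  have h := eVariationOn.edist_le γ.toFun (s := Icc γ.a γ.b ∩ Icc s t)
    ⟨⟨hs, hst.trans ht⟩, left_mem_Icc.2 hst⟩ ⟨⟨hs.trans hst, ht⟩, right_mem_Icc.2 hst⟩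
  rw [γ.unitSpeed ⟨hs, hst.trans ht⟩ ⟨hs.trans hst, ht⟩, edist_dist, NNReal.coe_one, one_mul,
    ENNReal.ofReal_le_ofReal_iff (sub_nonneg.2 hst)] at h
  exact h

lemma mul_volume_le_lineIntegral {g : X → ℝ≥0∞} {K : ℝ≥0∞} (γ : Curve X) {T : Set ℝ}
    (hT : MeasurableSet T) (hsub : T ⊆ Icc γ.a γ.b) (h : ∀ t ∈ T, g (γ.toFun t) = K) :
    K * volume T ≤ lineIntegral g γ := by
  refine le_trans (le_of_eq ?_) (lintegral_mono_set hsub)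
  rw [setLIntegral_congr_fun hT h, setLIntegral_const]

variable [MeasurableSpace X] [BorelSpace X]

/-- A `K`-Lipschitz function has the upper gradient `K χ_{φ ≠ 0}`. -/
lemma isUpperGradient_of_lipschitzWith {φ : X → ℝ} {K : ℝ≥0} (hφ : LipschitzWith K φ) :
    IsUpperGradient φ ({x | φ x ≠ 0}.indicator fun _ => (K : ℝ≥0∞)) := by
  refine ⟨measurable_const.indicator (hφ.continuous.measurable (measurableSet_singleton 0).compl),
    fun γ => ?_⟩
  have hlip : ∀ s t, γ.a ≤ s → s ≤ t → t ≤ γ.b →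
      |φ (γ.toFun t) - φ (γ.toFun s)| ≤ K * (t - s) := by
    intro s t hs hst ht
    rw [← Real.dist_eq, dist_comm]
    exact (hφ.dist_le_mul _ _).trans
      (mul_le_mul_of_nonneg_left (γ.dist_le hs hst ht) K.coe_nonneg)
  have hcont : ContinuousOn (fun t => φ (γ.toFun t)) (Icc γ.a γ.b) :=
    hφ.continuous.comp_continuousOn γ.continuousOn
  -- `φ` vanishes at the first and the last zero on the curve, so whatever happens in between does
  -- not affect the total increment. Before the first and after the last zero the upper gradient is
  -- `K`, which bounds the two remaining increments.
  set Z : Set ℝ := Icc γ.a γ.b ∩ (fun t => φ (γ.toFun t)) ⁻¹' {0} with hZ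
  have hcomp : IsCompact Z :=
    isCompact_Icc.of_isClosed_subset (hcont.preimage_isClosed_of_isClosed isClosed_Icc
      isClosed_singleton) inter_subset_left
  have hval : ∀ t ∈ Icc γ.a γ.b, t ∉ Z →
      {x | φ x ≠ 0}.indicator (fun _ => (K : ℝ≥0∞)) (γ.toFun t) = K := by
    intro t ht htZ
    refine indicator_of_mem ?_ _
    exact fun h0 => htZ ⟨ht, h0⟩
  rw [UpperGradientIneq]
  rcases Z.eq_empty_or_nonempty with hemp | hne
  · refine le_trans ?_ (mul_volume_le_lineIntegral γ measurableSet_Icc subset_rfl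
      fun t ht => hval t ht (by simp [hemp]))
    rw [Real.volume_Icc, ← ENNReal.ofReal_coe_nnreal, ← ENNReal.ofReal_mul K.coe_nonneg]
    exact ENNReal.ofReal_le_ofReal (hlip _ _ le_rfl γ.le le_rfl)
  · obtain ⟨s, hs, hsmin⟩ := hcomp.exists_isLeast hne
    obtain ⟨t, ht, htmax⟩ := hcomp.exists_isGreatest hne
    have hst : s ≤ t := hsmin ht
    have hs0 : φ (γ.toFun s) = 0 := hs.2
    have ht0 : φ (γ.toFun t) = 0 := ht.2
    refine le_trans ?_ (mul_volume_le_lineIntegral (K := K) γ (T := Ico γ.a s ∪ Ioc t γ.b)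
      (measurableSet_Ico.union measurableSet_Ioc) ?_ ?_)
    · rw [measure_union _ measurableSet_Ioc, Real.volume_Ico, Real.volume_Ioc,
        ← ENNReal.ofReal_add (sub_nonneg.2 hs.1.1) (sub_nonneg.2 ht.1.2),
        ← ENNReal.ofReal_coe_nnreal, ← ENNReal.ofReal_mul K.coe_nonneg]
      · refine ENNReal.ofReal_le_ofReal ?_
        have h1 := hlip γ.a s le_rfl hs.1.1 hs.1.2
        have h2 := hlip t γ.b ht.1.1 ht.1.2 le_rfl
        rw [hs0, abs_sub_comm, sub_zero] at h1
        rw [ht0, sub_zero] at h2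
        refine (abs_sub _ _).trans ?_
        linarith
      · exact disjoint_left.2 fun r hr hr' => absurd (hr.2.trans_le hst) (not_lt.2 hr'.1.le)
    · exact union_subset (fun r hr => ⟨hr.1, hr.2.le.trans hs.1.2⟩)
        fun r hr => ⟨ht.1.1.trans hr.1.le, hr.2⟩
    · rintro r (hr | hr)
      · exact hval r ⟨hr.1, hr.2.le.trans hs.1.2⟩ fun hrZ => absurd (hsmin hrZ) (not_le.2 hr.2)
      · exact hval r ⟨ht.1.1.trans hr.1.le, hr.2⟩ fun hrZ => absurd (htmax hrZ) (not_le.2 hr.1)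

variable {ν : Measure X} {p : ℝ} [hp : Fact (1 < p)]

/-- The factor `χ_{φ ≠ 0}` in the upper gradient is what makes it `p`-integrable, as `ν` may be
infinite. -/
lemma mem_D1p_of_lipschitzWith {φ : X → ℝ} {K : ℝ≥0} (hφ : LipschitzWith K φ)
    (hfin : ν {x | φ x ≠ 0} < ∞) : φ ∈ D1p ν p := by
  have h0 : 0 < p := zero_lt_one.trans hp.out
  have hm : MeasurableSet {x | φ x ≠ 0} :=
    hφ.continuous.measurable (measurableSet_singleton 0).compl
  refine ⟨hφ.continuous.measurable, _, isUpperGradient_of_lipschitzWith hφ, ?_⟩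
  have e : ∀ x, {x | φ x ≠ 0}.indicator (fun _ => (K : ℝ≥0∞)) x ^ p =
      {x | φ x ≠ 0}.indicator (fun _ => (K : ℝ≥0∞) ^ p) x := by
    intro x
    by_cases hx : φ x = 0 <;> simp [hx, h0]
  simp_rw [e]
  rw [lintegral_indicator hm, setLIntegral_const]
  exact ENNReal.mul_lt_top (ENNReal.rpow_lt_top_of_nonneg h0.le ENNReal.coe_ne_top) hfin

end Lipschitz

/-! ### Linearity of the differential and density of Sobolev functions in `L²`. -/

section Sobolev

variable {X : Type*} [MetricSpace X] [MeasurableSpace X] [BorelSpace X]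
variable {ν : Measure X} {p : ℝ} [hp : Fact (1 < p)]

/-- The space `W^{1,p}(X, d, ν) ∩ L^2(X, ν)`. -/
def sobolevSubmodule (ν : Measure X) (p : ℝ) [Fact (1 < p)] : Submodule ℝ (Lp ℝ 2 ν) where
  carrier := {u | IsSobolev p u}
  zero_mem' := ⟨⟨0, (Lp.coeFn_zero ℝ 2 ν).symm⟩, MemLp.zero.ae_eq (Lp.coeFn_zero ℝ 2 ν).symm⟩
  add_mem' := by
    rintro u v ⟨⟨f, hf⟩, hu⟩ ⟨⟨g, hg⟩, hv⟩
    exact ⟨⟨f + g, (hf.add hg).trans (Lp.coeFn_add u v).symm⟩,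
      (hu.add hv).ae_eq (Lp.coeFn_add u v).symm⟩
  smul_mem' := by
    rintro c u ⟨⟨f, hf⟩, hu⟩
    exact ⟨⟨c • f, (hf.const_smul c).trans (Lp.coeFn_smul c u).symm⟩,
      (hu.const_smul c).ae_eq (Lp.coeFn_smul c u).symm⟩

/-- The differential as a linear map on `W^{1,p}(X, d, ν) ∩ L^2(X, ν)`. -/
def sobolevDiff (ν : Measure X) (p : ℝ) [Fact (1 < p)] :
    sobolevSubmodule ν p →ₗ[ℝ] Cotangent ν p where
  toFun u := diff p (u : Lp ℝ 2 ν)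
  map_add' := by
    rintro ⟨u, hu⟩ ⟨v, hv⟩
    obtain ⟨f, hf⟩ := hu.1
    obtain ⟨g, hg⟩ := hv.1
    have h : ((f + g : D1p ν p) : X → ℝ) =ᵐ[ν] (u + v : Lp ℝ 2 ν) :=
      (hf.add hg).trans (Lp.coeFn_add u v).symm
    exact (diff_eq h).trans ((map_add _ _ _).trans
      (congrArg₂ (· + ·) (diff_eq hf).symm (diff_eq hg).symm))
  map_smul' := by
    rintro c ⟨u, hu⟩
    obtain ⟨f, hf⟩ := hu.1
    have h : ((c • f : D1p ν p) : X → ℝ) =ᵐ[ν] (c • u : Lp ℝ 2 ν) :=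
      (hf.const_smul c).trans (Lp.coeFn_smul c u).symm
    exact (diff_eq h).trans ((map_smul _ _ _).trans (congrArg (c • ·) (diff_eq hf).symm))

lemma sobolevDiff_apply (u : sobolevSubmodule ν p) :
    sobolevDiff ν p u = diff p (u : Lp ℝ 2 ν) := rfl

lemma diff_add {u v : Lp ℝ 2 ν} (hu : IsSobolev p u) (hv : IsSobolev p v) :
    diff p (u + v) = diff p u + diff p v :=
  (sobolevDiff ν p).map_add ⟨u, hu⟩ ⟨v, hv⟩

lemma diff_smul (c : ℝ) {u : Lp ℝ 2 ν} (hu : IsSobolev p u) :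
    diff p (c • u) = c • diff p u :=
  (sobolevDiff ν p).map_smul c ⟨u, hu⟩

lemma inner_eq_integral (u v : Lp ℝ 2 ν) : inner ℝ u v = ∫ x, v x * u x ∂ν := by
  rw [L2.inner_def]
  rfl

/-- Lipschitz cut-off functions of bounded sets are Sobolev. -/
lemma exists_mem_sobolevSubmodule_thickenedIndicator
    (hν : ∀ s : Set X, Bornology.IsBounded s → ν s < ∞) {s : Set X} (hs : Bornology.IsBounded s)
    {δ : ℝ} (hδ : 0 < δ) :
    ∃ u ∈ sobolevSubmodule ν p, u =ᵐ[ν] fun x => (thickenedIndicator hδ s x : ℝ) := by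
  set φ : X → ℝ := fun x => (thickenedIndicator hδ s x : ℝ) with hφ
  have hlip : LipschitzWith δ.toNNReal⁻¹ φ := by
    have := (LipschitzWith.of_edist_le (f := ((↑) : ℝ≥0 → ℝ))
      fun x y => le_rfl).comp (lipschitzWith_thickenedIndicator hδ s)
    rwa [one_mul] at this
  have hTfin := hν _ (hs.thickening (δ := δ))
  have hzero : ∀ x, x ∉ Metric.thickening δ s → φ x = 0 := fun x hx => by
    simp only [hφ, thickenedIndicator_zero hδ s hx, NNReal.coe_zero]
  have hfin : ν {x | φ x ≠ 0} < ∞ :=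
    (measure_mono fun x (hx : φ x ≠ 0) => by_contra fun h => hx (hzero x h)).trans_lt hTfin
  have hmem : ∀ q : ℝ≥0∞, MemLp φ q ν := by
    intro q
    refine (memLp_indicator_const q Metric.isOpen_thickening.measurableSet (1 : ℝ)
      (Or.inr hTfin.ne)).of_le hlip.continuous.aestronglyMeasurable (.of_forall fun x => ?_)
    by_cases hx : x ∈ Metric.thickening δ s
    · rw [indicator_of_mem hx, norm_one, Real.norm_of_nonneg (NNReal.coe_nonneg _)]
      exact_mod_cast thickenedIndicator_le_one hδ s x
    · rw [hzero x hx, norm_zero]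
      exact norm_nonneg _
  exact ⟨(hmem 2).toLp φ, ⟨⟨⟨φ, mem_D1p_of_lipschitzWith hlip hfin⟩, (hmem 2).coeFn_toLp.symm⟩,
    (hmem _).ae_eq (hmem 2).coeFn_toLp.symm⟩, (hmem 2).coeFn_toLp⟩

/-- Thickened indicators of `s` are Sobolev, hence orthogonal to `h`, and they converge pointwise to
the indicator of the closed set `s`. -/
lemma setIntegral_eq_zero_of_mem_orthogonal
    (hν : ∀ s : Set X, Bornology.IsBounded s → ν s < ∞) {h : Lp ℝ 2 ν}
    (hh : h ∈ (sobolevSubmodule ν p)ᗮ) {s : Set X} (hs : Bornology.IsBounded s)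
    (hcl : IsClosed s) : ∫ x in s, h x ∂ν = 0 := by
  set δ : ℕ → ℝ := fun n => 1 / ((n : ℝ) + 1) with hδ'
  have hδ : ∀ n, 0 < δ n := fun n => by simp only [hδ']; positivity
  have hδ1 : ∀ n, δ n ≤ 1 := fun n => by
    simp only [hδ']
    rw [div_le_one (by positivity)]
    linarith [n.cast_nonneg (α := ℝ)]
  -- All the cut-offs vanish off `T`, because the radii are at most `1`. As `T` is bounded it has
  -- finite measure, so `h` is integrable on it and provides the dominating function.
  set T := Metric.thickening 1 s with hT
  have hTm : MeasurableSet T := Metric.isOpen_thickening.measurableSet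
  have hint : Integrable (T.indicator h) ν :=
    (integrable_indicator_iff hTm).2
      (integrableOn_Lp_of_measure_ne_top h one_le_two (hν _ hs.thickening).ne)
  have hzero : ∀ n, ∫ x, (thickenedIndicator (hδ n) s x : ℝ) * h x ∂ν = 0 := by
    intro n
    obtain ⟨u, hu, hue⟩ := exists_mem_sobolevSubmodule_thickenedIndicator (p := p) hν hs (hδ n)
    have := (Submodule.mem_orthogonal _ _).1 hh u hu
    rw [inner_eq_integral] at this
    rw [← this]
    refine integral_congr_ae ?_
    filter_upwards [hue] with x hx
    rw [hx, mul_comm]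
  have hptw := tendsto_pi_nhds.1 (thickenedIndicator_tendsto_indicator_closure hδ
    tendsto_one_div_add_atTop_nhds_zero_nat s)
  rw [hcl.closure_eq] at hptw
  have hlim : Tendsto (fun n => ∫ x, (thickenedIndicator (hδ n) s x : ℝ) * h x ∂ν) atTop
      (𝓝 (∫ x, s.indicator h x ∂ν)) := by
    refine tendsto_integral_of_dominated_convergence (fun x => ‖T.indicator h x‖) (fun n => ?_)
      hint.norm (fun n => .of_forall fun x => ?_) (.of_forall fun x => ?_)
    · exact (NNReal.continuous_coe.comp
        (thickenedIndicator (hδ n) s).continuous).aestronglyMeasurable.mul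
        (Lp.stronglyMeasurable h).aestronglyMeasurable
    · by_cases hx : x ∈ T
      · rw [indicator_of_mem hx, norm_mul, Real.norm_of_nonneg (NNReal.coe_nonneg _)]
        refine mul_le_of_le_one_left (norm_nonneg _) ?_
        exact_mod_cast thickenedIndicator_le_one (hδ n) s x
      · rw [thickenedIndicator_zero (hδ n) s
          fun h' => hx (Metric.thickening_mono (hδ1 n) s h')]
        simp
    · have h1 : Tendsto (fun n => (thickenedIndicator (hδ n) s x : ℝ)) atTop
          (𝓝 ((s.indicator (fun _ => (1 : ℝ≥0)) x : ℝ≥0) : ℝ)) :=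
        (NNReal.continuous_coe.tendsto _).comp (hptw x)
      convert h1.mul_const (h x) using 2
      by_cases hx : x ∈ s <;> simp [hx]
  simp only [hzero] at hlim
  rw [← integral_indicator hcl.measurableSet]
  exact tendsto_nhds_unique hlim tendsto_const_nhds

/-- `W^{1,p}(X, d, ν) ∩ L^2(X, ν)` is dense in `L^2(X, ν)`. -/
theorem dense_sobolevSubmodule (hν : ∀ s : Set X, Bornology.IsBounded s → ν s < ∞) :
    Dense (sobolevSubmodule ν p : Set (Lp ℝ 2 ν)) := by
  rw [Submodule.dense_iff_topologicalClosure_eq_top, Submodule.topologicalClosure_eq_top_iff,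
    Submodule.eq_bot_iff]
  intro h hh
  refine (Lp.eq_zero_iff_ae_eq_zero).2 ?_
  rcases isEmpty_or_nonempty X with hX | ⟨⟨x₀⟩⟩
  · exact .of_forall fun x => (hX.false x).elim
  -- Localization to balls makes `h` integrable and turns every closed test set into a bounded one;
  -- vanishing integrals over closed sets then give `h = 0` almost everywhere.
  have hball : ∀ n : ℕ, ∀ᵐ x ∂ν, (Metric.closedBall x₀ n).indicator h x = 0 := by
    intro n
    have hm : MeasurableSet (Metric.closedBall x₀ (n : ℝ)) := Metric.isClosed_closedBall.measurableSet
    refine ae_eq_zero_of_forall_setIntegral_isClosed_eq_zero ((integrable_indicator_iff hm).2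
      (integrableOn_Lp_of_measure_ne_top h one_le_two (hν _ Metric.isBounded_closedBall).ne))
      fun s hs => ?_
    rw [setIntegral_indicator hm]
    exact setIntegral_eq_zero_of_mem_orthogonal hν hh
      (Metric.isBounded_closedBall.subset inter_subset_right) (hs.inter Metric.isClosed_closedBall)
  filter_upwards [ae_all_iff.2 hball] with x hx
  obtain ⟨n, hn⟩ := exists_nat_ge (dist x x₀)
  have := hx n
  rwa [indicator_of_mem (Metric.mem_closedBall.2 hn)] at this

end Sobolev

/-! ### The subdifferential of the energy, the divergence operator, and density of the domain. -/

section Subdifferential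

variable {X : Type*} [MetricSpace X] [MeasurableSpace X] [BorelSpace X]
variable {ν : Measure X} {p : ℝ} [hp : Fact (1 < p)] {E : Cotangent ν p → ℝ}

lemma energy_of_isSobolev {u : Lp ℝ 2 ν} (hu : IsSobolev p u) : energy E u = (E (diff p u) : EReal) :=
  if_pos hu

lemma energy_of_not_isSobolev {u : Lp ℝ 2 ν} (hu : ¬ IsSobolev p u) : energy E u = ⊤ :=
  if_neg hu

/-- The subdifferential of the energy in terms of real-valued inequalities. -/
lemma mem_subdifferential_energy_iff {u v : Lp ℝ 2 ν} :
    (u, v) ∈ subdifferential (energy E) ↔ IsSobolev p u ∧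
      ∀ w, IsSobolev p w → E (diff p u) + inner ℝ w v ≤ E (diff p u + diff p w) := by
  constructor
  · rintro ⟨hfin, h⟩
    have hu : IsSobolev p u := by
      by_contra hn
      rw [energy_of_not_isSobolev hn] at hfin
      exact lt_irrefl _ hfin
    refine ⟨hu, fun w hw => ?_⟩
    have := h w
    rw [energy_of_isSobolev hu, energy_of_isSobolev ((sobolevSubmodule ν p).add_mem hu hw),
      diff_add hu hw] at this
    exact_mod_cast this
  · rintro ⟨hu, h⟩
    refine ⟨by rw [energy_of_isSobolev hu]; exact EReal.coe_lt_top _, fun w => ?_⟩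
    -- Only Sobolev increments matter: `W` is a subspace, so if `w` is not Sobolev then neither is
    -- `u + w`, and the right-hand side is `⊤`.
    by_cases huw : IsSobolev p (u + w)
    · have hw : IsSobolev p w := by
        have := (sobolevSubmodule ν p).sub_mem huw hu
        rwa [add_sub_cancel_left] at this
      rw [energy_of_isSobolev hu, energy_of_isSobolev huw, diff_add hu hw]
      exact_mod_cast h w hw
    · rw [energy_of_not_isSobolev huw]
      exact le_top

/-- The easy half: test `V ∈ ∂E(du)` with `dw`; by the definition of the divergence, the pairing
integrates to `⟨w, v⟩`. -/
lemma divergenceOperator_subset_subdifferential :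
    divergenceOperator E ⊆ subdifferential (energy E) := by
  rintro ⟨u, v⟩ ⟨hu, V, hdiv, hV⟩
  refine mem_subdifferential_energy_iff.2 ⟨hu, fun w hw => ?_⟩
  have h1 := hdiv w hw
  have h2 := hV (diff p w)
  have e : ∫ x, (-v : Lp ℝ 2 ν) x * w x ∂ν = -inner ℝ w v := by
    rw [← inner_eq_integral, inner_neg_right]
  rw [e, neg_inj] at h1
  rw [← h1] at h2
  change inner ℝ w v ≤ E (diff p u + diff p w) - E (diff p u) at h2
  linarith

/-- The substantial half: the vector field is produced by extending `dw ↦ ⟨w, v⟩` from the range of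
`d` under the majorant `N`, and representing the extension. -/
lemma subdifferential_subset_divergenceOperator [SigmaFinite ν] (hE : ConvexOn ℝ univ E)
    (hc : Continuous E) : subdifferential (energy E) ⊆ divergenceOperator E := by
  rintro ⟨u, v⟩ huv
  obtain ⟨hu, h⟩ := mem_subdifferential_energy_iff.1 huv
  set N : Cotangent ν p → ℝ := fun w => E (diff p u + w) - E (diff p u) with hN
  set ℓ : sobolevSubmodule ν p →ₗ[ℝ] ℝ :=
    ((innerSL ℝ v).toLinearMap).comp (sobolevSubmodule ν p).subtype with hℓ
  have hℓ_apply : ∀ w, ℓ w = inner ℝ (w : Lp ℝ 2 ν) v := fun w => real_inner_comm (w : Lp ℝ 2 ν) v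
  have hℓN : ∀ w, ℓ w ≤ N (sobolevDiff ν p w) := fun w => by
    have := h w w.2
    rw [hℓ_apply, sobolevDiff_apply, hN]
    linarith
  -- If `dw = 0`, then `ℓ w` and `ℓ (-w)` are both at most `N 0 = 0`. So `ℓ` depends on `dw` alone.
  have hker : ℓ ∈ (sobolevDiff ν p).ker.dualAnnihilator := by
    rw [Submodule.mem_dualAnnihilator]
    intro w hw
    rw [LinearMap.mem_ker] at hw
    have h1 := hℓN w
    have h2 := hℓN (-w)
    rw [map_neg, map_neg, hw, neg_zero] at h2
    rw [hw] at h1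
    simp only [hN, add_zero, sub_self] at h1 h2
    linarith
  rw [← LinearMap.range_dualMap_eq_dualAnnihilator_ker] at hker
  -- `g` is a purely algebraic functional on the cotangent module, possibly discontinuous; only its
  -- restriction to the range of `d` is kept and extended anew.
  obtain ⟨g, hg⟩ := hker
  have hg' : ∀ w, g (sobolevDiff ν p w) = ℓ w := fun w => congrArg (fun k => k w) hg
  obtain ⟨L, hL, hLN⟩ := exists_continuousLinear_extension_of_le_convex (N := N)
    ((hE.translate_right (diff p u)).sub (concaveOn_const _ convex_univ)) (by fun_prop) (by simp [hN])
    ⟨(sobolevDiff ν p).range, g.domRestrict _⟩ (by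
      rintro ⟨_, w, rfl⟩
      exact (hg' w).trans_le (hℓN w))
  obtain ⟨V, hV⟩ := exists_vectorField_integral_eq L
  refine ⟨hu, V, fun w hw => ?_, fun w => (hV w).trans_le (hLN w)⟩
  rw [hV, ← inner_eq_integral, inner_neg_right]
  congr 1
  exact (hℓ_apply ⟨w, hw⟩).symm.trans ((hg' ⟨w, hw⟩).symm.trans (hL ⟨_, ⟨w, hw⟩, rfl⟩).symm)

lemma dense_domain_subdifferential (hν : ∀ s : Set X, Bornology.IsBounded s → ν s < ∞)
    (hE : ConvexOn ℝ univ E) (hpos : ∀ v, 0 ≤ E v) (hlsc : LowerSemicontinuous (energy E)) :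
    Dense {u : Lp ℝ 2 ν | ∃ v : Lp ℝ 2 ν, (u, v) ∈ subdifferential (energy E)} := by
  have hconv : ConvexOn ℝ (sobolevSubmodule ν p : Set (Lp ℝ 2 ν)) fun u => E (diff p u) := by
    refine ⟨(sobolevSubmodule ν p).convex, fun u hu v hv a b ha hb hab => ?_⟩
    have e : diff p (a • u + b • v) = a • diff p u + b • diff p v := by
      rw [diff_add ((sobolevSubmodule ν p).smul_mem a hu) ((sobolevSubmodule ν p).smul_mem b hv),
        diff_smul a hu, diff_smul b hv]
    change E (diff p (a • u + b • v)) ≤ _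
    rw [e]
    exact hE.2 (mem_univ _) (mem_univ _) ha hb hab
  -- For finite `a` these are the sublevel sets of the energy, which lower semicontinuity makes
  -- closed in `L²` although `W` need not be.
  have hclosed : ∀ a : ℝ, IsClosed {u : Lp ℝ 2 ν |
      u ∈ (sobolevSubmodule ν p : Set (Lp ℝ 2 ν)) ∧ E (diff p u) ≤ a} := by
    intro a
    convert hlsc.isClosed_preimage (a : EReal) using 1
    ext u
    by_cases hu : IsSobolev p u
    · have hu' : u ∈ sobolevSubmodule ν p := hu
      simp [hu', energy_of_isSobolev hu]
    · have hu' : u ∉ sobolevSubmodule ν p := hu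
      simp [hu', energy_of_not_isSobolev hu]
  have hsub := subset_closure_setOf_exists_subgradient hconv (fun u _ => hpos _) hclosed
  refine dense_iff_closure_eq.2 (eq_univ_of_univ_subset ?_)
  rw [← (dense_sobolevSubmodule (p := p) hν).closure_eq]
  -- The closure of the domain contains `W`, hence the closure of `W`, which is all of `L²`.
  refine closure_minimal (hsub.trans (closure_mono ?_)) isClosed_closure
  rintro u ⟨hu, v, hv⟩
  refine ⟨v, mem_subdifferential_energy_iff.2 ⟨hu, fun w hw => ?_⟩⟩
  have := hv (u + w) ((sobolevSubmodule ν p).add_mem hu hw)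
  rwa [add_sub_cancel_left, diff_add hu hw] at this

lemma Cotangent.ptNorm_nonneg (v : Cotangent ν p) : 0 ≤ Cotangent.ptNorm v := by
  induction v using UniformSpace.Completion.induction_on with
  | hp => exact isClosed_le continuous_const UniformSpace.Completion.continuous_extension
  | ih ω =>
    rw [Cotangent.ptNorm_coe, ← Lp.coeFn_nonneg]
    filter_upwards [ω.memLp.coeFn_toLp] with x hx
    exact (pcmNorm_nonneg _ x).trans_eq hx.symm

end Subdifferential

end MetricSobolev

end

theorem theorem3p1 {X : Type*} [MetricSpace X] [CompleteSpace X] [TopologicalSpace.SeparableSpace X]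
    [MeasurableSpace X] [BorelSpace X] (ν : Measure X)
    (hν : ∀ s : Set X, Bornology.IsBounded s → ν s < ∞)
    (p : ℝ) [Fact (1 < p)]
    (E : MetricSobolev.Cotangent ν p → ℝ)
    (hE_convex : ConvexOn ℝ Set.univ E) (hE_cont : Continuous E)
    (hE_coercive : ∃ C : ℝ, 0 < C ∧
      ∀ v : MetricSobolev.Cotangent ν p, C * ∫ x, MetricSobolev.Cotangent.ptNorm v x ^ p ∂ν ≤ E v)
    (hF_lsc : LowerSemicontinuous (MetricSobolev.energy E)) :
    MetricSobolev.divergenceOperator E = MetricSobolev.subdifferential (MetricSobolev.energy E) ∧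
      Dense {u : Lp ℝ 2 ν | ∃ v : Lp ℝ 2 ν,
        (u, v) ∈ MetricSobolev.subdifferential (MetricSobolev.energy E)} := by

  -- Second countability and local finiteness make `ν` σ-finite, as the Radon-Nikodym step requires.
  have := UniformSpace.secondCountable_of_separable X
  have : IsLocallyFiniteMeasure ν :=
    ⟨fun x => ⟨Metric.ball x 1, Metric.ball_mem_nhds x one_pos, hν _ Metric.isBounded_ball⟩⟩
  obtain ⟨C, hC, hCE⟩ := hE_coercive
  -- Coercivity enters only through nonnegativity of `E`, which bounds the proximal functionals
  -- below.
  have hpos : ∀ v, 0 ≤ E v := by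
    intro v
    refine le_trans (mul_nonneg hC.le (integral_nonneg_of_ae ?_)) (hCE v)
    filter_upwards [(Lp.coeFn_nonneg _).2 (MetricSobolev.Cotangent.ptNorm_nonneg v)] with x hx
    exact Real.rpow_nonneg hx p
  exact ⟨Subset.antisymm MetricSobolev.divergenceOperator_subset_subdifferential
    (MetricSobolev.subdifferential_subset_divergenceOperator hE_convex hE_cont),
    MetricSobolev.dense_domain_subdifferential hν hE_convex hpos hF_lsc⟩
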